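/- Let $T^k=(S^1)^k$. A smooth action of $T^k$ on a smooth manifold $M$ (Hausdorff, second countable, without boundary, not necessarily compact) is called locally standard if every orbit has an open invariant neighbourhood which is equivariantly diffeomorphic to some $V=\mathbb{C}^n\times T^{k-n}\times\mathbb{R}^m$ ($n,m$ may depend on the orbit), where, after a splitting $T^k\cong T^n\times T^{k-n}$, the factor $T^n$ acts on $\mathbb{C}^n$ by coordinatewise multiplication, $T^{k-n}$ acts on itself by left multiplication, and $T^k$ acts trivially on $\mathbb{R}^m$. Such an equivariant diffeomorphism is called a standard chart. Let $\pi:M\to P=M/T^k$ be the orbit map. Each standard chart induces a chart of $P$ with values in $\mathbb{R}_{\ge 0}^n\times\mathbb{R}^m$ through $(z_1,\dots,z_n,u,y)\mapsto(|z_1|^2,\dots,|z_n|^2,y)$, and these charts make $P$ a smooth manifold with corners. The characteristic function $\lambda$ of $M$ assigns to each orbit in $P$ its isotropy group, a subgroup of $T^k$. A section $s:P\to M$ of $\pi$ is called regular if every point of $P$ has an open neighbourhood on which, in the coordinates given by a standard chart and its induced chart of $P$, it has the form $s(x,y)=f(x,y)\cdot(\sqrt{x_1},\dots,\sqrt{x_n},1,y)$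 with a smooth map $f$ to $T^k$. Theorem. Let $M_i$, $i=1,2$, be two locally standard $T^k$-manifolds with orbit spaces $P_i$ and characteristic functions $\lambda_i$. Assume that there are regular sections $s_i:P_i\to M_i$. If $\Phi:P_1\to P_2$ is a diffeomorphism of manifolds with corners such that $\lambda_1=\lambda_2\circ\Phi$, then there is a unique equivariant diffeomorphism $\Psi:M_1\to M_2$ such that $\Psi\circ s_1=s_2\circ\Phi$. -/

import Mathlib

open scoped Manifold ContDiff

/-- The compact torus `T^k = (S¹)^k`. -/
abbrev Torus (k : ℕ) : Type := Fin k → Circle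

/-- The model with corners for the product smooth structure on `T^k`. -/
noncomputable abbrev torusModel (k : ℕ) :
    ModelWithCorners ℝ (Fin k → EuclideanSpace ℝ (Fin 1))
      (ModelPi fun _ : Fin k => EuclideanSpace ℝ (Fin 1)) :=
  ModelWithCorners.pi fun _ : Fin k => 𝓡 1

/-- The standard space `V = ℂ^n × T^l × ℝ^m`. -/
abbrev StdSpace (n l m : ℕ) : Type := (Fin n → ℂ) × Torus l × (Fin m → ℝ)

/-- The model with corners for the smooth structure on `ℂ^n × T^l × ℝ^m`. -/
noncomputable abbrev stdModel (n l m : ℕ) :=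
  (𝓘(ℝ, Fin n → ℂ)).prod ((torusModel l).prod 𝓘(ℝ, Fin m → ℝ))

/-- The standard action of `T^n × T^l` on `ℂ^n × T^l × ℝ^m`: coordinatewise multiplication on
`ℂ^n`, left multiplication on `T^l`, and the trivial action on `ℝ^m`. -/
noncomputable def stdAct {n l m : ℕ} (t : Torus n × Torus l) (v : StdSpace n l m) :
    StdSpace n l m :=
  (fun i => (t.1 i : ℂ) * v.1 i, t.2 * v.2.1, v.2.2)

/-- The Euclidean space containing the corner `ℝ_{≥0}^n × ℝ^m`. -/
abbrev CornerSpace (n m : ℕ) : Type := (Fin n → ℝ) × (Fin m → ℝ)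

/-- The corner `ℝ_{≥0}^n × ℝ^m`. -/
def corner (n m : ℕ) : Set (CornerSpace n m) := {w | ∀ i, 0 ≤ w.1 i}

/-- The orbit map `(z, u, y) ↦ (|z_1|², …, |z_n|², y)` of the standard action. -/
noncomputable def stdOrbitMap {n l m : ℕ} (v : StdSpace n l m) : CornerSpace n m :=
  (fun i => ‖v.1 i‖ ^ 2, v.2.2)

/-- The standard section `s₀(r, y) = (√r_1, …, √r_n, 1, y)` of the orbit map of the standard
action. -/
noncomputable def stdSection {n l m : ℕ} (w : CornerSpace n m) : StdSpace n l m :=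
  (fun i => ((Real.sqrt (w.1 i) : ℝ) : ℂ), 1, w.2)

/-- A standard chart of a `d`-dimensional manifold `M` with an action of `T^k`: an equivariant
diffeomorphism from an open invariant subset of `M` onto some `ℂ^n × T^l × ℝ^m`, where `T^k` acts
on the target through a splitting `T^k ≅ T^n × T^l` and the standard action. -/
structure StandardChart (k d : ℕ) (M : Type*) [TopologicalSpace M]
    [ChartedSpace (EuclideanSpace ℝ (Fin d)) M] [MulAction (Torus k) M] where
  n : ℕ
  l : ℕ
  m : ℕ
  n_add_l : n + l = k
  split : Torus k ≃ₜ* Torus n × Torus l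
  e : OpenPartialHomeomorph M (StdSpace n l m)
  target_eq : e.target = Set.univ
  smul_mem : ∀ (t : Torus k) (x : M), x ∈ e.source → t • x ∈ e.source
  equivariant : ∀ (t : Torus k) (x : M), x ∈ e.source → e (t • x) = stdAct (split t) (e x)
  contMDiffOn_toFun : ContMDiffOn (𝓡 d) (stdModel n l m) ∞ e e.source
  contMDiff_invFun : ContMDiff (stdModel n l m) (𝓡 d) ∞ e.symm

/-- A smooth `T^k`-action on the `d`-manifold `M` is locally standard if every orbit has an
invariant open neighbourhood which is the domain of a standard chart. -/
def IsLocallyStandard (k d : ℕ) (M : Type*) [TopologicalSpace M]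
    [ChartedSpace (EuclideanSpace ℝ (Fin d)) M] [MulAction (Torus k) M] : Prop :=
  ∀ x : M, ∃ c : StandardChart k d M, MulAction.orbit (Torus k) x ⊆ c.e.source

/-- The orbit space `M / T^k`, with the quotient topology. -/
abbrev OrbitSpace (k : ℕ) (M : Type*) [MulAction (Torus k) M] : Type _ :=
  MulAction.orbitRel.Quotient (Torus k) M

/-- The orbit map `M → M / T^k`. -/
noncomputable def orbitMk (k : ℕ) {M : Type*} [MulAction (Torus k) M] (x : M) : OrbitSpace k M :=
  Quotient.mk (MulAction.orbitRel (Torus k) M) x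

/-- The characteristic function of `M`, which maps each orbit to its isotropy group. -/
noncomputable def characteristicFunction (k : ℕ) {M : Type*} [MulAction (Torus k) M] (p : OrbitSpace k M) :
    Subgroup (Torus k) :=
  Quotient.lift (s := MulAction.orbitRel (Torus k) M)
    (fun x : M => MulAction.stabilizer (Torus k) x)
    (by
      rintro x y ⟨g, rfl⟩
      ext t
      simp only [MulAction.mem_stabilizer_iff]
      rw [smul_smul, mul_comm, ← smul_smul, smul_left_cancel_iff]) p

namespace StandardChart

variable {k d : ℕ} {M : Type*} [TopologicalSpace M]
  [ChartedSpace (EuclideanSpace ℝ (Fin d)) M] [MulAction (Torus k) M]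

/-- The open subset of the orbit space over which the standard chart is defined. -/
noncomputable def orbitDomain (c : StandardChart k d M) : Set (OrbitSpace k M) :=
  orbitMk k '' c.e.source

open Classical in
/-- The chart `M / T^k ⊇ U → ℝ_{≥0}^n × ℝ^m` of the orbit space induced by a standard chart,
`[x] ↦ (|z_1|², …, |z_n|², y)` where `(z, u, y)` are the coordinates of `x`
(with value `0` outside of `c.orbitDomain`). -/
noncomputable def orbitChart (c : StandardChart k d M) (p : OrbitSpace k M) :
    CornerSpace c.n c.m :=
  Quotient.lift (s := MulAction.orbitRel (Torus k) M)
    (fun x : M => if x ∈ c.e.source then stdOrbitMap (c.e x) else 0)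
    (by
      rintro x y ⟨g, rfl⟩
      by_cases hy : y ∈ c.e.source
      · have hgy := c.smul_mem g y hy
        simp only [hy, hgy, if_true, c.equivariant g y hy]
        simp only [stdOrbitMap, stdAct, norm_mul, Circle.norm_coe, one_mul]
      · have hgy : g • y ∉ c.e.source := fun h => hy (by simpa using c.smul_mem g⁻¹ _ h)
        simp only [hy, hgy, if_false]) p

/-- The standard section `s₀` in the coordinates of a standard chart, as a map to `M`. -/
noncomputable def localSection (c : StandardChart k d M) (w : CornerSpace c.n c.m) : M :=
  c.e.symm (stdSection w)

/-- The inverse `ℝ_{≥0}^n × ℝ^m → U ⊆ M / T^k` of the chart `c.orbitChart`. -/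
noncomputable def orbitChartInv (c : StandardChart k d M) (w : CornerSpace c.n c.m) :
    OrbitSpace k M :=
  orbitMk k (c.localSection w)

end StandardChart

/-- A map `Φ` between orbit spaces is smooth at `p`, for the structures of manifolds with corners
given by the charts induced by standard charts: it is continuous at `p`, and in some such charts
around `p` and `Φ p` it is smooth in a neighbourhood of `p`. -/
def OrbitSmoothAt (k d₁ d₂ : ℕ) {M₁ M₂ : Type*}
    [TopologicalSpace M₁] [ChartedSpace (EuclideanSpace ℝ (Fin d₁)) M₁] [MulAction (Torus k) M₁]
    [TopologicalSpace M₂] [ChartedSpace (EuclideanSpace ℝ (Fin d₂)) M₂] [MulAction (Torus k) M₂]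
    (Φ : OrbitSpace k M₁ → OrbitSpace k M₂) (p : OrbitSpace k M₁) : Prop :=
  ContinuousAt Φ p ∧
  ∃ (c₁ : StandardChart k d₁ M₁) (c₂ : StandardChart k d₂ M₂),
    p ∈ c₁.orbitDomain ∧ Φ p ∈ c₂.orbitDomain ∧
    ∃ W : Set (CornerSpace c₁.n c₁.m), IsOpen W ∧ c₁.orbitChart p ∈ W ∧
      ContDiffOn ℝ ∞ (fun w => c₂.orbitChart (Φ (c₁.orbitChartInv w))) (corner c₁.n c₁.m ∩ W)

/-- A bijection between orbit spaces is a diffeomorphism (of manifolds with corners) if it and its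
inverse are smooth at every point. -/
def IsOrbitDiffeomorphism (k d₁ d₂ : ℕ) {M₁ M₂ : Type*}
    [TopologicalSpace M₁] [ChartedSpace (EuclideanSpace ℝ (Fin d₁)) M₁] [MulAction (Torus k) M₁]
    [TopologicalSpace M₂] [ChartedSpace (EuclideanSpace ℝ (Fin d₂)) M₂] [MulAction (Torus k) M₂]
    (Φ : OrbitSpace k M₁ ≃ OrbitSpace k M₂) : Prop :=
  (∀ p, OrbitSmoothAt k d₁ d₂ Φ p) ∧ (∀ q, OrbitSmoothAt k d₂ d₁ Φ.symm q)

/-- A section `s` of the orbit map is regular if around every point `p`, in some standard chart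
over a neighbourhood of `p`, it has the form `s = f · s₀` near `p` with a smooth map `f` to `T^k`,
where `s₀(r, y) = (√r_1, …, √r_n, 1, y)`. -/
structure IsRegularSection (k d : ℕ) {M : Type*} [TopologicalSpace M]
    [ChartedSpace (EuclideanSpace ℝ (Fin d)) M] [MulAction (Torus k) M]
    (s : OrbitSpace k M → M) : Prop where
  isSection : ∀ p, orbitMk k (s p) = p
  regular : ∀ p, ∃ c : StandardChart k d M, p ∈ c.orbitDomain ∧
    ∃ W : Set (CornerSpace c.n c.m), IsOpen W ∧ c.orbitChart p ∈ W ∧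
    ∃ f : CornerSpace c.n c.m → Torus k,
      ContMDiffOn 𝓘(ℝ, CornerSpace c.n c.m) (torusModel k) ∞ f (corner c.n c.m ∩ W) ∧
      ∀ w ∈ corner c.n c.m ∩ W, s (c.orbitChartInv w) = f w • c.localSection w

/-! The equivariant map with `Ψ ∘ s₁ = s₂ ∘ Φ` can only be `t • s₁ p ↦ t • s₂ (Φ p)`, and this is
well defined because `Φ` matches the isotropy groups; the point is its smoothness, which is local.
As the sections are regular, in standard charts `Ψ` is, up to a smooth factor in the torus, the map
`x ↦ A (phases x) • s₀ (φ (|x|²))`, where `φ` is a diffeomorphism of corners and `A` an isomorphism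
of tori. The isotropy group over an interior point of a wall is a coordinate circle, so `φ` maps
walls to walls, with `A` mapping the coordinate circle of the `i`-th wall onto that of the `j`-th.
By Hadamard's lemma `φ_j = x_i * r` with `r` smooth and nonvanishing, and the root of `|z_i|²`
combines with the phase of `z_i`, on which `A` acts by identity or inversion, to `z_i` or its
conjugate. The remaining characters are trivial on the coordinate circles where `z_i = 0`, so they
involve only the phases of nonzero `z_i`, which are smooth.

Functions on a corner are handled by pulling them back along the squaring map: by Whitney's theorem
a smooth function which is even in each corner coordinate is a smooth function of their squares.
This also shows that smoothness on orbit spaces does not depend on the choice of standard charts.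
-/

open Set Filter Topology

section ParametricIntegral

universe u

variable {E F : Type u} [NormedAddCommGroup E] [NormedSpace ℝ E]
  [NormedAddCommGroup F] [NormedSpace ℝ F] {D : E × ℝ → F}

theorem hasFDerivAt_intervalIntegral_of_contDiff (hD : ContDiff ℝ 1 D) (a b : ℝ) (x : E) :
    HasFDerivAt (fun y => ∫ s in a..b, D (y, s))
      (∫ s in a..b, (fderiv ℝ D (x, s)).comp (ContinuousLinearMap.inl ℝ E ℝ)) x := by
  let D' : E × ℝ → (E →L[ℝ] F) := fun q => (fderiv ℝ D q).comp (ContinuousLinearMap.inl ℝ E ℝ)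
  have hD' : Continuous D' := (hD.continuous_fderiv one_ne_zero).clm_comp continuous_const
  have hderiv (y : E) (s : ℝ) : HasFDerivAt (fun y => D (y, s)) (D' (y, s)) y :=
    (hD.differentiable one_ne_zero (y, s)).hasFDerivAt.comp y (hasFDerivAt_prodMk_left y s)
  have hslice (y : E) : Continuous fun s => D (y, s) :=
    hD.continuous.comp (Continuous.prodMk_right y)
  obtain ⟨C, hC⟩ := (isCompact_singleton.prod isCompact_uIcc).exists_bound_of_continuousOn
    (s := {x} ×ˢ uIcc a b) hD'.continuousOn
  obtain ⟨U, V, hU, -, hxU, hV, hUV⟩ := generalized_tube_lemma isCompact_singleton isCompact_uIcc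
    (isOpen_lt hD'.norm continuous_const) (fun q hq => (hC q hq).trans_lt (lt_add_one C))
  exact intervalIntegral.hasFDerivAt_integral_of_dominated_of_fderiv_le
    (bound := fun _ => C + 1) (hU.mem_nhds (hxU rfl))
    (Eventually.of_forall fun y => (hslice y).aestronglyMeasurable)
    ((hslice x).intervalIntegrable a b)
    (hD'.comp (Continuous.prodMk_right x)).aestronglyMeasurable
    (Eventually.of_forall fun s hs y hy => (hUV ⟨hy, hV (uIoc_subset_uIcc hs)⟩).le) (by simp)
    (Eventually.of_forall fun s _ y _ => hderiv y s)

theorem contDiff_intervalIntegral (hD : ContDiff ℝ ∞ D) (a b : ℝ) :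
    ContDiff ℝ ∞ fun x => ∫ s in a..b, D (x, s) := by
  rw [contDiff_infty]
  intro n
  induction n generalizing F with
  | zero =>
    rw [Nat.cast_zero, contDiff_zero]
    exact intervalIntegral.continuous_parametric_intervalIntegral_of_continuous'
      (f := fun x s => D (x, s)) hD.continuous a b
  | succ n ih =>
    rw [Nat.cast_succ, contDiff_succ_iff_hasFDerivAt]
    exact ⟨_, ih ((hD.fderiv_right (m := ∞) le_rfl).clm_comp contDiff_const),
      hasFDerivAt_intervalIntegral_of_contDiff (hD.of_le (mod_cast le_top)) a b⟩

end ParametricIntegral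

namespace CornerSpace

variable {n m : ℕ}

/-- The `i`-th unit vector of the corner directions. -/
noncomputable def unit (i : Fin n) : CornerSpace n m := (Pi.single i 1, 0)

/-- The linear map that multiplies the corner coordinates by `c`: a reflection if `c * c = 1`, the
retraction to the `i`-th coordinate hyperplane if `c = Function.update 1 i 0`. -/
noncomputable def scale (c : Fin n → ℝ) : CornerSpace n m →L[ℝ] CornerSpace n m :=
  (ContinuousLinearMap.mul ℝ (Fin n → ℝ) c).prodMap (.id ℝ (Fin m → ℝ))

/-- The squaring map of the corner coordinates, through which functions on the corner are pulled
back to functions on all of `CornerSpace n m`. -/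
def sq (p : CornerSpace n m) : CornerSpace n m := (p.1 ^ 2, p.2)

/-- The square root of the corner coordinates, a right inverse of `CornerSpace.sq` on the corner. -/
noncomputable def sqrt (w : CornerSpace n m) : CornerSpace n m := (fun i => √(w.1 i), w.2)

/-- A function is even if it is invariant under the reflections in the coordinate hyperplanes of the
corner directions. -/
def IsEven {F : Type*} (G : CornerSpace n m → F) : Prop :=
  ∀ c : Fin n → ℝ, c * c = 1 → ∀ p, G (scale c p) = G p

theorem scale_apply (c : Fin n → ℝ) (p : CornerSpace n m) : scale c p = (c * p.1, p.2) := rfl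

theorem scale_unit (c : Fin n → ℝ) (i : Fin n) :
    scale c (unit i : CornerSpace n m) = c i • unit i := by
  simp [scale_apply, unit, ← Pi.single_mul_right, ← Pi.single_smul]

theorem scale_scale_comm (c d : Fin n → ℝ) (p : CornerSpace n m) :
    scale c (scale d p) = scale d (scale c p) := by
  simp only [scale_apply, mul_left_comm]

theorem scale_update_one (i : Fin n) (s : ℝ) (p : CornerSpace n m) :
    scale (Function.update 1 i s) p = p + ((s - 1) * p.1 i) • unit i := by
  refine Prod.ext (funext fun j => ?_) (by simp [scale_apply, unit])
  rcases eq_or_ne j i with rfl | hj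
  · simp only [scale_apply, unit, Pi.mul_apply, Prod.fst_add, Pi.add_apply, Prod.smul_fst,
      Pi.smul_apply, Function.update_self, Pi.single_eq_same, smul_eq_mul]
    ring
  · simp [scale_apply, unit, hj]

theorem sq_mem_corner (p : CornerSpace n m) : sq p ∈ corner n m := fun i => sq_nonneg (p.1 i)

theorem sq_sqrt {w : CornerSpace n m} (hw : w ∈ corner n m) : sq (sqrt w) = w :=
  Prod.ext (funext fun i => Real.sq_sqrt (hw i)) rfl

theorem contDiff_sq : ContDiff ℝ ∞ (sq : CornerSpace n m → CornerSpace n m) := by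
  unfold sq; fun_prop

theorem continuous_sqrt : Continuous (sqrt : CornerSpace n m → CornerSpace n m) := by
  unfold sqrt; fun_prop

theorem isEven_comp_sq {F : Type*} (f : CornerSpace n m → F) : IsEven (f ∘ sq) := fun c hc p => by
  simp only [Function.comp_apply, sq, scale_apply, mul_pow, pow_two c, hc, one_mul]

theorem IsEven.apply_sqrt_sq {F : Type*} {G : CornerSpace n m → F} (hG : IsEven G)
    (p : CornerSpace n m) : G (sqrt (sq p)) = G p := by
  let c : Fin n → ℝ := fun i => if 0 ≤ p.1 i then 1 else -1
  have hc : c * c = 1 := funext fun i => by by_cases h : 0 ≤ p.1 i <;> simp [c, h]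
  have hp : sqrt (sq p) = scale c p := by
    refine Prod.ext (funext fun i => ?_) rfl
    by_cases h : 0 ≤ p.1 i
    · simp [sqrt, sq, scale_apply, c, h, Real.sqrt_sq h]
    · simp [sqrt, sq, scale_apply, c, h, Real.sqrt_sq_eq_abs, abs_of_neg (not_le.1 h)]
  rw [hp, hG c hc]

theorem hasFDerivAt_sqrt {w : CornerSpace n m} (hw : ∀ i, 0 < w.1 i) :
    HasFDerivAt sqrt (scale fun i => (2 * √(w.1 i))⁻¹) w := by
  have hcoord (i : Fin n) := ((ContinuousLinearMap.proj (R := ℝ) (φ := fun _ : Fin n => ℝ) i).comp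
    (ContinuousLinearMap.fst ℝ (Fin n → ℝ) (Fin m → ℝ))).hasFDerivAt (x := w)
  refine ((hasFDerivAt_pi.2 fun i => (hcoord i).sqrt (hw i).ne').prodMk
    hasFDerivAt_snd).congr_fderiv ?_
  ext v <;> simp [scale_apply]

theorem eq_sum_unit (v : CornerSpace n m) : v = ∑ i, v.1 i • unit i + (0, v.2) := by
  refine Prod.ext (funext fun j => ?_) ?_
  · simp [unit, Prod.fst_sum, Finset.sum_apply, Pi.single_apply]
  · simp [unit, Prod.snd_sum]

/-- The open face of the corner on which exactly the corner coordinates in `S` vanish. -/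
def stratum (m : ℕ) (S : Set (Fin n)) : Set (CornerSpace n m) :=
  {w | (∀ i ∈ S, w.1 i = 0) ∧ ∀ i ∉ S, 0 < w.1 i}

open Classical in
theorem stratum_eq_prod (S : Set (Fin n)) :
    stratum m S = (univ.pi fun i => if i ∈ S then {0} else Ioi 0) ×ˢ univ := by
  ext w
  simp only [stratum, mem_ofPred_eq, mem_prod, mem_univ_pi, mem_univ, and_true, ← forall_and]
  refine forall_congr' fun i => ?_
  by_cases hi : i ∈ S <;> simp [hi]

theorem stratum_subset_corner (S : Set (Fin n)) : stratum m S ⊆ corner n m := fun w hw i => by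
  by_cases hi : i ∈ S
  exacts [(hw.1 i hi).ge, (hw.2 i hi).le]

theorem closure_stratum (S : Set (Fin n)) :
    closure (stratum m S) = {w ∈ corner n m | ∀ i ∈ S, w.1 i = 0} := by
  classical
  ext w
  simp only [stratum_eq_prod, closure_prod_eq, closure_pi_set, closure_univ, mem_prod, mem_univ_pi,
    mem_univ, and_true, corner, mem_ofPred_eq, ← forall_and]
  refine forall_congr' fun i => ?_
  by_cases hi : i ∈ S
  · simpa [hi] using fun h : w.1 i = 0 => h.ge
  · simp [hi]

theorem closure_stratum_empty : closure (stratum m ∅) = corner n m := by simp [closure_stratum]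

theorem isOpen_stratum_empty : IsOpen (stratum m (∅ : Set (Fin n))) := by
  simpa [stratum_eq_prod] using
    (isOpen_set_pi finite_univ fun (_ : Fin n) _ => isOpen_Ioi (a := (0 : ℝ))).prod
      (isOpen_univ (X := Fin m → ℝ))

theorem convex_stratum_empty : Convex ℝ (stratum m (∅ : Set (Fin n))) := by
  simpa [stratum_eq_prod] using
    (convex_pi fun (i : Fin n) _ => convex_Ioi (𝕜 := ℝ) (0 : ℝ)).prod
      (convex_univ (E := Fin m → ℝ))

theorem uniqueDiffOn_corner : UniqueDiffOn ℝ (corner n m) := by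
  rw [← closure_stratum_empty]
  exact uniqueDiffOn_convex convex_stratum_empty.closure
    ⟨(1, 0), interior_maximal subset_closure isOpen_stratum_empty (by simp [stratum])⟩

variable {F : Type} [NormedAddCommGroup F] [NormedSpace ℝ F]

/-- The partial derivative in the `i`-th corner coordinate. -/
noncomputable def partialDeriv (i : Fin n) (G : CornerSpace n m → F) (p : CornerSpace n m) : F :=
  fderiv ℝ G p (unit i)

/-- The quotient of `G` by the `i`-th corner coordinate `p.1 i`, for a smooth `G` that vanishes on
the hyperplane `p.1 i = 0`, given by Hadamard's integral formula. -/
noncomputable def hadamardQuotient (i : Fin n) (G : CornerSpace n m → F) (p : CornerSpace n m) :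
    F :=
  ∫ s in (0 : ℝ)..1, partialDeriv i G (scale (Function.update 1 i s) p)

section Smooth

variable {G : CornerSpace n m → F}

theorem contDiff_partialDeriv (i : Fin n) (hG : ContDiff ℝ ∞ G) :
    ContDiff ℝ ∞ (partialDeriv i G) :=
  (hG.fderiv_right le_rfl).clm_apply contDiff_const

theorem contDiff_hadamardQuotient (i : Fin n) (hG : ContDiff ℝ ∞ G) :
    ContDiff ℝ ∞ (hadamardQuotient i G) := by
  have hscale : ContDiff ℝ ∞ fun q : CornerSpace n m × ℝ =>
      scale (Function.update 1 i q.2) q.1 := by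
    simp only [scale_update_one]; fun_prop
  exact contDiff_intervalIntegral ((contDiff_partialDeriv i hG).comp hscale) 0 1

theorem smul_hadamardQuotient [CompleteSpace F] (i : Fin n) (hG : ContDiff ℝ ∞ G)
    (h0 : ∀ p, p.1 i = 0 → G p = 0) (p : CornerSpace n m) :
    p.1 i • hadamardQuotient i G p = G p := by
  let γ : ℝ → CornerSpace n m := fun s => scale (Function.update 1 i s) p
  have hγ (s : ℝ) : HasDerivAt γ (p.1 i • unit i) s := by
    simpa [γ, scale_update_one] using ((((hasDerivAt_id s).sub_const 1).mul_const
      (p.1 i)).smul_const (unit i : CornerSpace n m)).const_add p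
  have hGγ (s : ℝ) : HasDerivAt (G ∘ γ) (p.1 i • partialDeriv i G (γ s)) s := by
    simpa [partialDeriv] using
      (hG.differentiable (by simp) (γ s)).hasFDerivAt.comp_hasDerivAt s (hγ s)
  have hcont : Continuous fun s => p.1 i • partialDeriv i G (γ s) :=
    ((contDiff_partialDeriv i hG).continuous.comp
      (continuous_iff_continuousAt.2 fun s => (hγ s).continuousAt)).const_smul (p.1 i)
  have hFTC := intervalIntegral.integral_eq_sub_of_hasDerivAt (fun s _ => hGγ s)
    (hcont.intervalIntegrable 0 1)
  rw [intervalIntegral.integral_smul] at hFTC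
  rw [hadamardQuotient, hFTC, Function.comp_apply, Function.comp_apply,
    h0 (γ 0) (by simp [γ, scale_apply])]
  simp [γ, scale_update_one]

theorem partialDeriv_comp_scale (i : Fin n) (hG : ContDiff ℝ ∞ G) (c : Fin n → ℝ)
    (p : CornerSpace n m) :
    partialDeriv i (G ∘ scale c) p = c i • partialDeriv i G (scale c p) := by
  rw [partialDeriv, fderiv_comp p (hG.differentiable (by simp) _) (scale c).differentiableAt,
    ContinuousLinearMap.fderiv, ContinuousLinearMap.comp_apply, scale_unit, map_smul, partialDeriv]

theorem hadamardQuotient_comp_scale (i : Fin n) (hG : ContDiff ℝ ∞ G) (c : Fin n → ℝ)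
    (p : CornerSpace n m) :
    hadamardQuotient i (G ∘ scale c) p = c i • hadamardQuotient i G (scale c p) := by
  simp only [hadamardQuotient, partialDeriv_comp_scale i hG, intervalIntegral.integral_smul,
    scale_scale_comm c]

theorem hadamardQuotient_const_smul (i : Fin n) (a : ℝ) (G : CornerSpace n m → F) :
    hadamardQuotient i (a • G) = a • hadamardQuotient i G := by
  funext p
  simp only [hadamardQuotient, partialDeriv, fderiv_const_smul_field, Pi.smul_apply,
    _root_.smul_apply, intervalIntegral.integral_smul]

end Smooth

/-- A function is odd in the `i`-th corner coordinate, and even in the others, if a reflection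
changes it by the sign with which the reflection acts on this coordinate. -/
def IsOddIn (i : Fin n) (H : CornerSpace n m → F) : Prop :=
  ∀ c : Fin n → ℝ, c * c = 1 → c i • (H ∘ scale c) = H

theorem IsEven.isOddIn_partialDeriv {G : CornerSpace n m → F} (hG : IsEven G)
    (hGs : ContDiff ℝ ∞ G) (i : Fin n) : IsOddIn i (partialDeriv i G) := fun c hc => by
  funext p
  rw [Pi.smul_apply, Function.comp_apply, ← partialDeriv_comp_scale i hGs]
  exact congrArg (partialDeriv i · p) (funext (hG c hc))

theorem IsEven.isOddIn_hadamardQuotient {G : CornerSpace n m → F} (hG : IsEven G)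
    (hGs : ContDiff ℝ ∞ G) (i : Fin n) : IsOddIn i (hadamardQuotient i G) := fun c hc => by
  funext p
  rw [Pi.smul_apply, Function.comp_apply, ← hadamardQuotient_comp_scale i hGs]
  exact congrArg (hadamardQuotient i · p) (funext (hG c hc))

namespace IsOddIn

variable {i : Fin n} {H : CornerSpace n m → F}

theorem eq_zero (hH : IsOddIn i H) {p : CornerSpace n m} (hp : p.1 i = 0) : H p = 0 := by
  have h := congrFun (hH (Function.update 1 i (-1)) (by simp [← Function.update_mul])) p
  have := IsAddTorsionFree.of_isTorsionFree ℝ F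
  simpa [scale_update_one, hp, neg_eq_self] using h

theorem isEven_hadamardQuotient (hH : IsOddIn i H) (hHs : ContDiff ℝ ∞ H) :
    IsEven (hadamardQuotient i H) := fun c hc p => by
  have hcc : c i * c i = 1 := congrFun hc i
  conv_rhs => rw [← hH c hc]
  rw [hadamardQuotient_const_smul, Pi.smul_apply, hadamardQuotient_comp_scale i hHs, smul_smul,
    hcc, one_smul]

end IsOddIn

/-- The derivative at `sq p` of the function `f` on the corner with `f ∘ sq = G`, for even `G`. By
the chain rule, `∂ᵢG p = 2 * p.1 i • ∂ᵢf (sq p)`. -/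
noncomputable def fderivOfCompSq (G : CornerSpace n m → F) (p : CornerSpace n m) :
    CornerSpace n m →L[ℝ] F :=
  ∑ i, ((2 : ℝ)⁻¹ • (ContinuousLinearMap.proj i).comp
      (ContinuousLinearMap.fst ℝ (Fin n → ℝ) (Fin m → ℝ))).smulRight
        (hadamardQuotient i (partialDeriv i G) p) +
    (fderiv ℝ G p).comp (scale 0)

theorem fderivOfCompSq_apply (G : CornerSpace n m → F) (p v : CornerSpace n m) :
    fderivOfCompSq G p v =
      ∑ i, (2⁻¹ * v.1 i) • hadamardQuotient i (partialDeriv i G) p + fderiv ℝ G p (scale 0 v) := by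
  simp [fderivOfCompSq]

theorem contDiff_fderivOfCompSq {G : CornerSpace n m → F} (hG : ContDiff ℝ ∞ G) :
    ContDiff ℝ ∞ (fderivOfCompSq G) :=
  (ContDiff.sum fun i _ => contDiff_const.smulRight
    (contDiff_hadamardQuotient i (contDiff_partialDeriv i hG))).add
      ((hG.fderiv_right le_rfl).clm_comp contDiff_const)

theorem IsEven.fderivOfCompSq {G : CornerSpace n m → F} (hG : IsEven G) (hGs : ContDiff ℝ ∞ G) :
    IsEven (fderivOfCompSq G) := fun c hc p => by
  have heven (i : Fin n) : IsEven (hadamardQuotient i (partialDeriv i G)) :=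
    (hG.isOddIn_partialDeriv hGs i).isEven_hadamardQuotient (contDiff_partialDeriv i hGs)
  have hfderiv (v : CornerSpace n m) :
      fderiv ℝ G (scale c p) (scale 0 v) = fderiv ℝ G p (scale 0 v) := by
    have h : fderiv ℝ (G ∘ scale c) p (scale 0 v) = fderiv ℝ G p (scale 0 v) := by
      rw [show G ∘ scale c = G from funext (hG c hc)]
    rw [← h, fderiv_comp p (hGs.differentiable (by simp) _) (scale c).differentiableAt,
      ContinuousLinearMap.fderiv, ContinuousLinearMap.comp_apply]
    simp [scale_apply]
  refine ContinuousLinearMap.ext fun v => ?_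
  simp only [fderivOfCompSq_apply, heven _ c hc p, hfderiv]

theorem hasFDerivAt_of_comp_sq [CompleteSpace F] {f : CornerSpace n m → F}
    (hf : ContDiff ℝ ∞ (f ∘ sq)) {w : CornerSpace n m} (hw : w ∈ stratum m ∅) :
    HasFDerivAt f (fderivOfCompSq (f ∘ sq) (sqrt w)) w := by
  have hw' (i : Fin n) : 0 < w.1 i := hw.2 i (notMem_empty i)
  have hcomp := (hf.differentiable (by simp) (sqrt w)).hasFDerivAt.comp w (hasFDerivAt_sqrt hw')
  have heq : (f ∘ sq) ∘ sqrt =ᶠ[𝓝 w] f := by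
    filter_upwards [isOpen_stratum_empty.mem_nhds hw] with v hv
    exact congrArg f (sq_sqrt (stratum_subset_corner _ hv))
  refine (hcomp.congr_of_eventuallyEq heq.symm).congr_fderiv (ContinuousLinearMap.ext fun v => ?_)
  have hpartial (i : Fin n) := smul_hadamardQuotient i (contDiff_partialDeriv i hf)
    (fun p => ((isEven_comp_sq f).isOddIn_partialDeriv hf i).eq_zero) (sqrt w)
  rw [ContinuousLinearMap.comp_apply, eq_sum_unit (scale _ v), map_add, map_sum,
    fderivOfCompSq_apply]
  congr 1
  · refine Finset.sum_congr rfl fun i _ => ?_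
    have hpos : √(w.1 i) ≠ 0 := (Real.sqrt_pos.2 (hw' i)).ne'
    rw [map_smul, ← partialDeriv, ← hpartial, smul_smul]
    congr 1
    simp only [scale_apply, Pi.mul_apply, sqrt]
    field_simp
  · simp [scale_apply]

theorem hasFDerivWithinAt_of_comp_sq [CompleteSpace F] {f : CornerSpace n m → F}
    (hf : ContDiff ℝ ∞ (f ∘ sq)) (w : CornerSpace n m) :
    HasFDerivWithinAt f (fderivOfCompSq (f ∘ sq) (sqrt w)) (corner n m) w := by
  have heq : EqOn f ((f ∘ sq) ∘ sqrt) (corner n m) := fun v hv => (congrArg f (sq_sqrt hv)).symm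
  have hcont : ContinuousOn f (corner n m) :=
    (hf.continuous.comp continuous_sqrt).continuousOn.congr heq
  have hint {v : CornerSpace n m} (hv : v ∈ stratum m ∅) := hasFDerivAt_of_comp_sq hf hv
  rw [← closure_stratum_empty] at hcont ⊢
  refine hasFDerivWithinAt_closure_of_tendsto_fderiv
    (fun v hv => (hint hv).differentiableAt.differentiableWithinAt) convex_stratum_empty
    isOpen_stratum_empty (fun v hv => (hcont v hv).mono subset_closure) ?_
  refine (((contDiff_fderivOfCompSq hf).continuous.comp continuous_sqrt).continuousWithinAt
    (s := stratum m ∅)).tendsto.congr' ?_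
  filter_upwards [self_mem_nhdsWithin] with v hv using (hint hv).fderiv.symm

/-- Whitney's theorem on even functions. -/
theorem contDiffOn_corner_of_comp_sq [CompleteSpace F] {f : CornerSpace n m → F}
    (hf : ContDiff ℝ ∞ (f ∘ sq)) : ContDiffOn ℝ ∞ f (corner n m) := by
  rw [contDiffOn_infty]
  intro N
  induction N generalizing F with
  | zero =>
    rw [Nat.cast_zero, contDiffOn_zero]
    exact fun w _ => (hasFDerivWithinAt_of_comp_sq hf w).continuousWithinAt
  | succ N ih =>
    rw [Nat.cast_succ, contDiffOn_succ_iff_hasFDerivWithinAt_of_uniqueDiffOn uniqueDiffOn_corner]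
    refine ⟨by simp, fun w => fderivOfCompSq (f ∘ sq) (sqrt w), ih ?_,
      fun w _ => hasFDerivWithinAt_of_comp_sq hf w⟩
    convert contDiff_fderivOfCompSq hf using 1
    exact funext ((isEven_comp_sq f).fderivOfCompSq hf).apply_sqrt_sq

end CornerSpace

section Cutoff

variable {E F : Type*} [NormedAddCommGroup E] [NormedSpace ℝ E]
  [NormedAddCommGroup F] [NormedSpace ℝ F] {s W : Set E}

theorem exists_contDiff_eventuallyEq_one_tsupport_subset [FiniteDimensional ℝ E] {x : E}
    (hW : W ∈ 𝓝 x) : ∃ χ : E → ℝ, ContDiff ℝ ∞ χ ∧ χ =ᶠ[𝓝 x] 1 ∧ tsupport χ ⊆ W := by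
  obtain ⟨χ, -, hχ⟩ := (SmoothBumpFunction.nhds_basis_tsupport (I := 𝓘(ℝ, E)) x).mem_iff.1 hW
  exact ⟨χ, χ.contMDiff.contDiff, χ.eventuallyEq_one, hχ⟩

theorem contDiffOn_smul_of_tsupport_subset {χ : E → ℝ} {f : E → F} (hχ : ContDiff ℝ ∞ χ)
    (hχW : tsupport χ ⊆ W) (hW : IsOpen W) (hf : ContDiffOn ℝ ∞ f (s ∩ W)) :
    ContDiffOn ℝ ∞ (χ • f) s := fun x hx => by
  by_cases hxW : x ∈ W
  · exact hχ.contDiffWithinAt.smul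
      ((hf x ⟨hx, hxW⟩).mono_of_mem_nhdsWithin (inter_mem_nhdsWithin s (hW.mem_nhds hxW)))
  · refine (contDiffAt_const (c := (0 : F))).congr_of_eventuallyEq ?_ |>.contDiffWithinAt
    filter_upwards [notMem_tsupport_iff_eventuallyEq.1 fun h => hxW (hχW h)] with y hy
    rw [Pi.smul_apply', hy, Pi.zero_apply, zero_smul]

end Cutoff

namespace CornerSpace

variable {n m : ℕ} {F : Type} [NormedAddCommGroup F] [NormedSpace ℝ F] [CompleteSpace F]
  {f : CornerSpace n m → F} {W : Set (CornerSpace n m)}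

theorem contDiffOn_corner_inter_of_comp_sq (hW : IsOpen W)
    (hf : ContDiffOn ℝ ∞ (f ∘ sq) (sq ⁻¹' W)) : ContDiffOn ℝ ∞ f (corner n m ∩ W) :=
  fun w hw => by
  obtain ⟨χ, hχ, hχ1, hχW⟩ :=
    exists_contDiff_eventuallyEq_one_tsupport_subset (hW.mem_nhds hw.2)
  have hcut : ContDiff ℝ ∞ ((χ • f) ∘ sq) := contDiffOn_univ.1 <|
    contDiffOn_smul_of_tsupport_subset (hχ.comp contDiff_sq)
      ((tsupport_comp_subset_preimage χ contDiff_sq.continuous).trans (preimage_mono hχW))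
      (hW.preimage contDiff_sq.continuous) (by rwa [univ_inter])
  refine ((contDiffOn_corner_of_comp_sq hcut w hw.1).congr_of_eventuallyEq_of_mem ?_ hw.1).mono
    inter_subset_left
  filter_upwards [mem_nhdsWithin_of_mem_nhds hχ1] with v hv
  rw [Pi.smul_apply', hv, Pi.one_apply, one_smul]

theorem exists_contDiffOn_corner_smul_eq (i : Fin n) (hf : ContDiffOn ℝ ∞ f (corner n m))
    (h0 : ∀ w ∈ corner n m, w.1 i = 0 → f w = 0) :
    ∃ h : CornerSpace n m → F, ContDiffOn ℝ ∞ h (corner n m) ∧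
      ∀ w ∈ corner n m, w.1 i • h w = f w := by
  have hG : ContDiff ℝ ∞ (f ∘ sq) := hf.comp_contDiff contDiff_sq sq_mem_corner
  have hG0 (p : CornerSpace n m) (hp : p.1 i = 0) : (f ∘ sq) p = 0 :=
    h0 _ (sq_mem_corner p) (by simp [sq, hp])
  have hQ := contDiff_hadamardQuotient i hG
  have hodd := (isEven_comp_sq f).isOddIn_hadamardQuotient hG i
  let R := hadamardQuotient i (hadamardQuotient i (f ∘ sq))
  have hR : R ∘ sqrt ∘ sq = R := funext (hodd.isEven_hadamardQuotient hQ).apply_sqrt_sq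
  refine ⟨R ∘ sqrt, contDiffOn_corner_of_comp_sq (hR.symm ▸ contDiff_hadamardQuotient i hQ),
    fun w hw => ?_⟩
  have hfactor := smul_hadamardQuotient i hG hG0 (sqrt w)
  rw [← smul_hadamardQuotient i hQ (fun p => hodd.eq_zero), smul_smul, Function.comp_apply,
    sq_sqrt hw] at hfactor
  rw [← hfactor, sqrt, Real.mul_self_sqrt (hw i)]
  rfl

theorem exists_contDiffOn_corner_eventually_smul_eq (i : Fin n) (hW : IsOpen W)
    (hf : ContDiffOn ℝ ∞ f (corner n m ∩ W)) (h0 : ∀ w ∈ corner n m ∩ W, w.1 i = 0 → f w = 0)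
    {w₀ : CornerSpace n m} (hw₀ : w₀ ∈ W) :
    ∃ h : CornerSpace n m → F, ContDiffOn ℝ ∞ h (corner n m) ∧
      ∀ᶠ w in 𝓝[corner n m] w₀, w.1 i • h w = f w := by
  obtain ⟨χ, hχ, hχ1, hχW⟩ :=
    exists_contDiff_eventuallyEq_one_tsupport_subset (hW.mem_nhds hw₀)
  obtain ⟨h, hh, heq⟩ := exists_contDiffOn_corner_smul_eq i
    (contDiffOn_smul_of_tsupport_subset hχ hχW hW hf) fun w hw hwi => by
      by_cases hwW : w ∈ W
      · rw [Pi.smul_apply', h0 w ⟨hw, hwW⟩ hwi, smul_zero]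
      · rw [Pi.smul_apply', image_eq_zero_of_notMem_tsupport fun h => hwW (hχW h), zero_smul]
  refine ⟨h, hh, ?_⟩
  filter_upwards [self_mem_nhdsWithin, mem_nhdsWithin_of_mem_nhds hχ1] with w hw hw1
  rw [heq w hw, Pi.smul_apply', hw1, Pi.one_apply, one_smul]

end CornerSpace

section Phase

/-- The phase `z / |z|` of a complex number, with the convention that the phase of `0` is `1`. -/
noncomputable def phase (z : ℂ) : Circle := Circle.exp z.arg

theorem norm_mul_phase (z : ℂ) : (‖z‖ : ℂ) * phase z = z := by
  rw [phase, Circle.coe_exp, Complex.norm_mul_exp_arg_mul_I]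

theorem norm_mul_phase_inv (z : ℂ) : (‖z‖ : ℂ) * ((phase z)⁻¹ : Circle) = star z := by
  conv_rhs => rw [← norm_mul_phase z]
  rw [Circle.coe_inv_eq_conj, star_mul', Complex.star_def, Complex.conj_ofReal]

theorem phase_mul {z w : ℂ} (hz : z ≠ 0) (hw : w ≠ 0) : phase (z * w) = phase z * phase w := by
  have hnorm : (‖z * w‖ : ℂ) ≠ 0 := by simp [hz, hw]
  refine Circle.ext (mul_left_cancel₀ hnorm ?_)
  rw [norm_mul_phase, norm_mul, Complex.ofReal_mul, Circle.coe_mul, mul_mul_mul_comm,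
    norm_mul_phase, norm_mul_phase]

end Phase

section SmoothMaps

variable {E H X : Type*} [NormedAddCommGroup E] [NormedSpace ℝ E] [TopologicalSpace H]
  {I : ModelWithCorners ℝ E H} [TopologicalSpace X] [ChartedSpace H X] {x : X}

theorem contMDiff_circle_coe : ContMDiff (𝓡 1) 𝓘(ℝ, ℂ) ∞ (fun z : Circle => (z : ℂ)) :=
  haveI : Fact (Module.finrank ℝ ℂ = 1 + 1) := finrank_real_complex_fact'
  contMDiff_coe_sphere

theorem contMDiffAt_phase {g : X → ℂ} (hg : ContMDiffAt I 𝓘(ℝ, ℂ) ∞ g x) (hx : g x ≠ 0) :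
    ContMDiffAt I (𝓡 1) ∞ (fun y => phase (g y)) x := by
  -- Rotating `g x` to `1` moves `g` near `x` away from the branch cut of the logarithm.
  have hlog : ContDiffAt ℝ ∞ (fun z : ℂ => (Complex.log ((g x)⁻¹ * z)).im) (g x) := by
    have hslit : (g x)⁻¹ * g x ∈ Complex.slitPlane := by
      rw [inv_mul_cancel₀ hx]; exact Complex.one_mem_slitPlane
    have hmul : ContDiffAt ℝ ∞ (fun z : ℂ => (g x)⁻¹ * z) (g x) := by fun_prop
    exact Complex.imCLM.contDiff.contDiffAt.comp _
      (((Complex.contDiffAt_log hslit).restrict_scalars ℝ).comp _ hmul)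
  have hlocal : ContMDiffAt I (𝓡 1) ∞
      (fun y => phase (g x) * Circle.exp (Complex.log ((g x)⁻¹ * g y)).im) x :=
    contMDiffAt_const.mul (contMDiff_circleExp.contMDiffAt.comp x
      (ContMDiffAt.comp (g := fun z : ℂ => (Complex.log ((g x)⁻¹ * z)).im) x hlog.contMDiffAt hg))
  refine hlocal.congr_of_eventuallyEq ?_
  filter_upwards [hg.continuousAt.eventually_ne hx] with y hy
  rw [Complex.log_im, ← phase, ← phase_mul hx (mul_ne_zero (inv_ne_zero hx) hy),
    mul_inv_cancel_left₀ hx]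

theorem contMDiffAt_circle_zpow {g : X → Circle} (hg : ContMDiffAt I (𝓡 1) ∞ g x) (a : ℤ) :
    ContMDiffAt I (𝓡 1) ∞ (fun y => g y ^ a) x := by
  cases a with
  | ofNat a => simpa using hg.pow a
  | negSucc a => simpa [zpow_negSucc] using (hg.pow (a + 1)).inv

theorem contMDiffAt_complex_mul {f g : X → ℂ} (hf : ContMDiffAt I 𝓘(ℝ, ℂ) ∞ f x)
    (hg : ContMDiffAt I 𝓘(ℝ, ℂ) ∞ g x) : ContMDiffAt I 𝓘(ℝ, ℂ) ∞ (fun y => f y * g y) x :=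
  ContMDiffAt.comp x (g := fun p : ℂ × ℂ => p.1 * p.2) contDiff_mul.contMDiff.contMDiffAt
    (hf.prodMk_space hg)

section Torus

variable {s : Set X} {k : ℕ} {f g : X → Torus k}

theorem contMDiffWithinAt_torus_iff : ContMDiffWithinAt I (torusModel k) ∞ f s x ↔
    ∀ i, ContMDiffWithinAt I (𝓡 1) ∞ (fun y => f y i) s x := by
  rw [contMDiffWithinAt_iff_target]
  have hcoord : ∀ i, ContMDiffWithinAt I (𝓡 1) ∞ (fun y => f y i) s x ↔
      ContinuousWithinAt (fun y => f y i) s x ∧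
        ContMDiffWithinAt I 𝓘(ℝ, EuclideanSpace ℝ (Fin 1)) ∞
          (extChartAt (𝓡 1) (f x i) ∘ fun y => f y i) s x :=
    fun i => contMDiffWithinAt_iff_target
  simp only [hcoord, forall_and, continuousWithinAt_pi]
  exact and_congr_right fun _ => contMDiffWithinAt_pi_space

theorem contMDiffAt_torus_iff :
    ContMDiffAt I (torusModel k) ∞ f x ↔ ∀ i, ContMDiffAt I (𝓡 1) ∞ (fun y => f y i) x :=
  contMDiffWithinAt_torus_iff

theorem contMDiffWithinAt_torus_mul (hf : ContMDiffWithinAt I (torusModel k) ∞ f s x)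
    (hg : ContMDiffWithinAt I (torusModel k) ∞ g s x) :
    ContMDiffWithinAt I (torusModel k) ∞ (fun y => f y * g y) s x :=
  contMDiffWithinAt_torus_iff.2 fun i =>
    (contMDiffWithinAt_torus_iff.1 hf i).mul (contMDiffWithinAt_torus_iff.1 hg i)

theorem contMDiffWithinAt_torus_inv (hf : ContMDiffWithinAt I (torusModel k) ∞ f s x) :
    ContMDiffWithinAt I (torusModel k) ∞ (fun y => (f y)⁻¹) s x :=
  contMDiffWithinAt_torus_iff.2 fun i => (contMDiffWithinAt_torus_iff.1 hf i).inv

end Torus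

end SmoothMaps

section Characters

theorem exists_forall_circle_hom_eq_zpow (χ : Circle →ₜ* Circle) : ∃ a : ℤ, ∀ z, χ z = z ^ a := by
  obtain ⟨g, ⟨hg0, hg⟩, -⟩ := Circle.isCoveringMap_exp.existsUnique_continuousMap_lifts
    ⟨fun t : ℝ => χ (Circle.exp t), χ.continuous.comp Circle.exp.continuous⟩ 0 0 (by simp)
  have hlift : ∀ t, Circle.exp (g t) = χ (Circle.exp t) := fun t => congrFun hg t
  have hadd : ∀ s t, g (s + t) = g s + g t := fun s =>
    congrFun (Circle.isCoveringMap_exp.eq_of_comp_eq (by fun_prop) (by fun_prop)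
      (funext fun t => by simp only [Function.comp, hlift, Circle.exp_add, map_mul]) 0
      (by simp [hg0]))
  have hlinear : ∀ t : ℝ, g t = t * g 1 := fun t => by
    simpa using map_real_smul (AddMonoidHom.mk' g hadd) g.continuous t (1 : ℝ)
  obtain ⟨a, ha⟩ := Circle.exp_eq_one.1
    (show Circle.exp (g (2 * Real.pi)) = 1 by rw [hlift, Circle.exp_two_pi, map_one])
  have hslope : g 1 = a := by
    rw [hlinear, mul_comm] at ha
    exact mul_right_cancel₀ Real.two_pi_pos.ne' ha
  refine ⟨a, fun z => ?_⟩
  obtain ⟨t, rfl⟩ := Circle.exp_surjective z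
  rw [← hlift, hlinear, hslope, mul_comm, ← zsmul_eq_mul, Circle.exp_zsmul]

theorem isUnit_of_injective_circle_zpow {a : ℤ}
    (ha : Function.Injective fun z : Circle => z ^ a) : IsUnit a := by
  have hker : ∀ z : Circle, z ^ a = 1 → z = 1 := fun z hz => ha (hz.trans (one_zpow a).symm)
  have ha0 : (a : ℝ) ≠ 0 := by
    intro ha0
    obtain rfl : a = 0 := by exact_mod_cast ha0
    exact Circle.exp_pi_ne_one (hker _ (zpow_zero _))
  obtain ⟨b, hb⟩ := Circle.exp_eq_one.1 (hker (Circle.exp (2 * Real.pi / a)) (by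
    rw [← Circle.exp_zsmul, zsmul_eq_mul, mul_div_cancel₀ _ ha0, Circle.exp_two_pi]))
  have hba : (1 : ℝ) = a * b := by
    rw [div_eq_iff ha0] at hb
    exact mul_left_cancel₀ Real.two_pi_pos.ne' (by linarith)
  exact .of_mul_eq_one b (by exact_mod_cast hba.symm)

theorem circle_hom_eq_id_or_inv_of_injective {χ : Circle →ₜ* Circle} (hχ : Function.Injective χ) :
    (∀ z, χ z = z) ∨ ∀ z, χ z = z⁻¹ := by
  obtain ⟨a, ha⟩ := exists_forall_circle_hom_eq_zpow χ
  rcases Int.isUnit_iff.1 (isUnit_of_injective_circle_zpow (funext ha ▸ hχ)) with rfl | rfl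
  · exact .inl fun z => by rw [ha, zpow_one]
  · exact .inr fun z => by rw [ha, zpow_neg_one]

/-- The inclusion of the `i`-th coordinate circle of the first factor of `T^n × T^l`. -/
noncomputable def coordCircle {n l : ℕ} (i : Fin n) : Circle →ₜ* Torus n × Torus l where
  toMonoidHom := (MonoidHom.inl _ _).comp (MonoidHom.mulSingle (fun _ => Circle) i)
  continuous_toFun :=
    (continuous_mulSingle (A := fun _ : Fin n => Circle) i).prodMk continuous_const

/-- The inclusion of the `i`-th coordinate circle of the second factor of `T^n × T^l`. -/
noncomputable def coordCircleSnd {n l : ℕ} (i : Fin l) : Circle →ₜ* Torus n × Torus l where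
  toMonoidHom := (MonoidHom.inr _ _).comp (MonoidHom.mulSingle (fun _ => Circle) i)
  continuous_toFun := continuous_const.prodMk
    (continuous_mulSingle (A := fun _ : Fin l => Circle) i)

variable {n l m : ℕ}

theorem coordCircle_apply (i : Fin n) (z : Circle) :
    (coordCircle i z : Torus n × Torus l) = (Pi.mulSingle i z, 1) := rfl

theorem coordCircleSnd_apply (i : Fin l) (z : Circle) :
    (coordCircleSnd i z : Torus n × Torus l) = (1, Pi.mulSingle i z) := rfl

theorem coordCircle_fst_self (i : Fin n) (z : Circle) :
    (coordCircle i z : Torus n × Torus l).1 i = z :=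
  Pi.mulSingle_eq_same (M := fun _ => Circle) i z

theorem coordCircle_fst_of_ne {i j : Fin n} (hij : i ≠ j) (z : Circle) :
    (coordCircle j z : Torus n × Torus l).1 i = 1 :=
  Pi.mulSingle_eq_of_ne (M := fun _ => Circle) hij z

theorem coordCircle_injective (i : Fin n) :
    Function.Injective (coordCircle i : Circle →ₜ* Torus n × Torus l) := fun z z' h => by
  rw [← coordCircle_fst_self (l := l) i z, h, coordCircle_fst_self]

theorem map_eq_prod_coordCircle {G : Type*} [CommMonoid G] (χ : Torus n × Torus l →* G)
    (t : Torus n × Torus l) :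
    χ t = (∏ i, χ (coordCircle i (t.1 i))) * ∏ i, χ (coordCircleSnd i (t.2 i)) := by
  rw [← map_prod, ← map_prod, ← map_mul]
  simp only [coordCircle_apply, coordCircleSnd_apply, ← prod_mk_prod, Finset.univ_prod_mulSingle,
    Finset.prod_const_one, Prod.mk_mul_mk, mul_one, one_mul]

/-- The element of `T^n × T^l` which moves the point over the same orbit in the image of the
standard section to `x`. -/
noncomputable def phases (x : StdSpace n l m) : Torus n × Torus l :=
  (fun i => phase (x.1 i), x.2.1)

theorem contMDiffAt_character_phases (χ : Torus n × Torus l →ₜ* Circle) {x : StdSpace n l m}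
    (hχ : ∀ i, x.1 i = 0 → ∀ z, χ (coordCircle i z) = 1) :
    ContMDiffAt (stdModel n l m) (𝓡 1) ∞ (fun y : StdSpace n l m => χ (phases y)) x := by
  have hfst : ∀ i, ContMDiffAt (stdModel n l m) 𝓘(ℝ, ℂ) ∞
      (fun y : StdSpace n l m => y.1 i) x := fun i => contMDiffAt_pi_space.1 contMDiffAt_fst i
  have hsnd : ∀ i, ContMDiffAt (stdModel n l m) (𝓡 1) ∞
      (fun y : StdSpace n l m => y.2.1 i) x := fun i =>
    contMDiffAt_torus_iff.1 (contMDiffAt_fst.comp x contMDiffAt_snd) i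
  have hprod := fun y : StdSpace n l m => map_eq_prod_coordCircle χ.toMonoidHom (phases y)
  refine ContMDiffAt.congr_of_eventuallyEq (.mul (contMDiffAt_finsetProd fun i _ => ?_)
    (contMDiffAt_finsetProd fun i _ => ?_)) (.of_forall hprod)
  · by_cases hi : x.1 i = 0
    · exact contMDiffAt_const.congr_of_eventuallyEq (.of_forall fun y => hχ i hi _)
    · obtain ⟨a, ha⟩ := exists_forall_circle_hom_eq_zpow (χ.comp (coordCircle i))
      exact (contMDiffAt_circle_zpow (contMDiffAt_phase (hfst i) hi) a).congr_of_eventuallyEq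
        (.of_forall fun y => ha _)
  · obtain ⟨a, ha⟩ := exists_forall_circle_hom_eq_zpow (χ.comp (coordCircleSnd i))
    exact (contMDiffAt_circle_zpow (hsnd i) a).congr_of_eventuallyEq (.of_forall fun y => ha _)

end Characters

section CornerDiffeo

open CornerSpace

variable {n l m n' l' m' : ℕ}

/-- The isotropy group of the standard action of `T^n × T^l` on the orbit over `w`. -/
def stdIsotropy (w : CornerSpace n m) : Set (Torus n × Torus l) :=
  {t | (∀ i, w.1 i ≠ 0 → t.1 i = 1) ∧ t.2 = 1}

theorem coordCircle_mem_stdIsotropy {i : Fin n} {w : CornerSpace n m} (hi : w.1 i = 0)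
    (z : Circle) : (coordCircle i z : Torus n × Torus l) ∈ stdIsotropy w :=
  ⟨fun _ hj => coordCircle_fst_of_ne (by rintro rfl; exact hj hi) z, rfl⟩

theorem range_coordCircle_subset_stdIsotropy {i : Fin n} {w : CornerSpace n m} :
    range (coordCircle i : Circle → Torus n × Torus l) ⊆ stdIsotropy w ↔ w.1 i = 0 := by
  refine ⟨fun h => ?_, fun hi => range_subset_iff.2 (coordCircle_mem_stdIsotropy hi)⟩
  by_contra hi
  refine Circle.exp_pi_ne_one ?_
  rw [← coordCircle_fst_self (l := l) i (Circle.exp Real.pi)]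
  exact (h (mem_range_self _)).1 i hi

theorem stdIsotropy_eq_range_coordCircle {i : Fin n} {w : CornerSpace n m} (hi : w.1 i = 0)
    (hne : ∀ j ≠ i, w.1 j ≠ 0) :
    stdIsotropy w = range (coordCircle i : Circle → Torus n × Torus l) := by
  refine (range_coordCircle_subset_stdIsotropy.2 hi).antisymm' fun t ht =>
    ⟨t.1 i, Prod.ext (funext fun j => ?_) ht.2.symm⟩
  rcases eq_or_ne j i with rfl | hj
  · exact coordCircle_fst_self j _
  · rw [coordCircle_fst_of_ne hj, ht.1 j (hne j hj)]

theorem exists_eq_zero_of_nontrivial_stdIsotropy {w : CornerSpace n m}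
    (h : (stdIsotropy w : Set (Torus n × Torus l)).Nontrivial) : ∃ i, w.1 i = 0 := by
  by_contra! hne
  obtain ⟨t, ht, t', ht', htt'⟩ := h
  exact htt' (Prod.ext (funext fun i => (ht.1 i (hne i)).trans (ht'.1 i (hne i)).symm)
    (ht.2.trans ht'.2.symm))

theorem nontrivial_range_coordCircle (i : Fin n) :
    (range (coordCircle i : Circle → Torus n × Torus l)).Nontrivial :=
  ⟨_, mem_range_self _, _, mem_range_self _,
    (coordCircle_injective i).ne Circle.exp_pi_ne_one⟩

theorem exists_mem_stratum_of_eventually {w₀ : CornerSpace n m} (hw₀ : w₀ ∈ corner n m)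
    {S : Set (Fin n)} (hS : ∀ i ∈ S, w₀.1 i = 0) {p : CornerSpace n m → Prop}
    (hp : ∀ᶠ w in 𝓝[corner n m] w₀, p w) : ∃ w ∈ stratum m S, p w := by
  have hclosure : w₀ ∈ closure (stratum m S) := (closure_stratum S).symm ▸ ⟨hw₀, hS⟩
  have := mem_closure_iff_nhdsWithin_neBot.1 hclosure
  exact (eventually_mem_nhdsWithin.and
    (hp.filter_mono (nhdsWithin_mono _ (stratum_subset_corner S)))).exists

/-- `φ` is a diffeomorphism between relatively open subsets of two corners which matches the
isotropy groups of the standard actions under the isomorphism `A` of tori. -/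
structure IsCornerDiffeo (A : Torus n × Torus l ≃ₜ* Torus n' × Torus l')
    (φ : PartialEquiv (CornerSpace n m) (CornerSpace n' m')) : Prop where
  source_subset : φ.source ⊆ corner n m
  target_subset : φ.target ⊆ corner n' m'
  source_mem_nhdsWithin : ∀ w ∈ φ.source, φ.source ∈ 𝓝[corner n m] w
  target_mem_nhdsWithin : ∀ v ∈ φ.target, φ.target ∈ 𝓝[corner n' m'] v
  contDiffOn : ContDiffOn ℝ ∞ φ φ.source
  contDiffOn_symm : ContDiffOn ℝ ∞ φ.symm φ.target
  preimage_stdIsotropy : ∀ w ∈ φ.source, A ⁻¹' stdIsotropy (φ w) = stdIsotropy w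

namespace IsCornerDiffeo

variable {A : Torus n × Torus l ≃ₜ* Torus n' × Torus l'}
  {φ : PartialEquiv (CornerSpace n m) (CornerSpace n' m')} {w₀ : CornerSpace n m}
  {i : Fin n} {j : Fin n'}

theorem symm (h : IsCornerDiffeo A φ) : IsCornerDiffeo A.symm φ.symm where
  source_subset := h.target_subset
  target_subset := h.source_subset
  source_mem_nhdsWithin := h.target_mem_nhdsWithin
  target_mem_nhdsWithin := h.source_mem_nhdsWithin
  contDiffOn := h.contDiffOn_symm
  contDiffOn_symm := h.contDiffOn
  preimage_stdIsotropy v hv := by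
    rw [← h.preimage_stdIsotropy _ (φ.map_target hv), φ.right_inv hv, ← preimage_comp]
    exact congrArg (· ⁻¹' stdIsotropy v) (funext A.apply_symm_apply)

theorem tendsto (h : IsCornerDiffeo A φ) (hw₀ : w₀ ∈ φ.source) :
    Tendsto φ (𝓝[corner n m] w₀) (𝓝[corner n' m'] (φ w₀)) := by
  have hsource := h.source_mem_nhdsWithin w₀ hw₀
  refine tendsto_nhdsWithin_of_tendsto_nhds_of_eventually_within _ ?_ ?_
  · exact ((h.contDiffOn.continuousOn w₀ hw₀).mono_of_mem_nhdsWithin hsource).tendsto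
  · filter_upwards [hsource] with w hw using h.target_subset (φ.map_source hw)

theorem exists_preimage_range_coordCircle (h : IsCornerDiffeo A φ) (hw₀ : w₀ ∈ φ.source)
    (hj : (φ w₀).1 j = 0) :
    ∃ i, w₀.1 i = 0 ∧ A ⁻¹' range (coordCircle j) = range (coordCircle i) := by
  have hnear : ∃ v ∈ stratum m' {j}, v ∈ φ.target :=
    exists_mem_stratum_of_eventually (h.target_subset (φ.map_source hw₀))
      (by rintro _ rfl; exact hj) (h.target_mem_nhdsWithin _ (φ.map_source hw₀))
  obtain ⟨v, ⟨hvj, hv⟩, hv_target⟩ := hnear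
  have hv_source := φ.map_target hv_target
  obtain ⟨i, hi⟩ : ∃ i, (φ.symm v).1 i = 0 := by
    refine exists_eq_zero_of_nontrivial_stdIsotropy (l := l) ?_
    rw [← h.preimage_stdIsotropy _ hv_source, φ.right_inv hv_target]
    exact ((nontrivial_range_coordCircle j).mono
      (range_coordCircle_subset_stdIsotropy.2 (hvj j rfl))).preimage A.surjective
  have hφ_ne : ∀ᶠ w in 𝓝[corner n m] φ.symm v, ∀ j' ≠ j, (φ w).1 j' ≠ 0 := by
    have htendsto := tendsto_nhds_of_tendsto_nhdsWithin (h.tendsto hv_source)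
    rw [φ.right_inv hv_target] at htendsto
    refine eventually_all.2 fun j' => eventually_imp_distrib_left.2 fun hj' => ?_
    exact (((continuous_apply j').comp continuous_fst).continuousAt.tendsto.comp
      htendsto).eventually_ne (hv j' hj').ne'
  obtain ⟨w, ⟨hwi, hw⟩, hw_source, hw_ne⟩ := exists_mem_stratum_of_eventually
    (h.source_subset hv_source) (S := {i}) (by rintro _ rfl; exact hi)
    (Filter.Eventually.and (h.source_mem_nhdsWithin _ hv_source) hφ_ne)
  have hiso := h.preimage_stdIsotropy w hw_source
  rw [stdIsotropy_eq_range_coordCircle (hwi i rfl) fun i' hi' => (hw i' hi').ne'] at hiso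
  obtain ⟨j', hj'⟩ : ∃ j', (φ w).1 j' = 0 := by
    refine exists_eq_zero_of_nontrivial_stdIsotropy (l := l')
      (nontrivial_of_preimage A.injective _ ?_)
    exact hiso ▸ nontrivial_range_coordCircle i
  obtain rfl : j' = j := by_contra fun hne => hw_ne j' hne hj'
  rw [stdIsotropy_eq_range_coordCircle hj' hw_ne] at hiso
  refine ⟨i, (range_coordCircle_subset_stdIsotropy (l := l)).1 ?_, hiso⟩
  rw [← hiso, ← h.preimage_stdIsotropy w₀ hw₀]
  exact preimage_mono (range_coordCircle_subset_stdIsotropy.2 hj)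

theorem apply_eq_zero_iff (h : IsCornerDiffeo A φ) (hw₀ : w₀ ∈ φ.source)
    (hA : A ⁻¹' range (coordCircle j) = range (coordCircle i)) :
    (φ w₀).1 j = 0 ↔ w₀.1 i = 0 := by
  rw [← range_coordCircle_subset_stdIsotropy (l := l'),
    ← range_coordCircle_subset_stdIsotropy (l := l), ← hA, ← h.preimage_stdIsotropy w₀ hw₀,
    A.surjective.preimage_subset_preimage_iff]

theorem map_coordCircle_eq_one_of_ne (h : IsCornerDiffeo A φ) (hw₀ : w₀ ∈ φ.source)
    (hA : A ⁻¹' range (coordCircle j) = range (coordCircle i)) {i' : Fin n}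
    (hi' : w₀.1 i' = 0) (hne : i' ≠ i) (z : Circle) : (A (coordCircle i' z)).1 j = 1 := by
  obtain ⟨w, ⟨hwi', hw⟩, hw_source⟩ := exists_mem_stratum_of_eventually (S := {i'})
    (h.source_subset hw₀) (by rintro _ rfl; exact hi') (h.source_mem_nhdsWithin w₀ hw₀)
  have hφj : (φ w).1 j ≠ 0 := fun h0 =>
    (hw i hne.symm).ne' ((h.apply_eq_zero_iff hw_source hA).1 h0)
  have hmem : coordCircle i' z ∈ A ⁻¹' stdIsotropy (φ w) := by
    rw [h.preimage_stdIsotropy w hw_source]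
    exact coordCircle_mem_stdIsotropy (hwi' i' rfl) z
  exact hmem.1 j hφj

theorem exists_contDiffOn_eventually_eq_smul (h : IsCornerDiffeo A φ) (hw₀ : w₀ ∈ φ.source)
    (hA : A ⁻¹' range (coordCircle j) = range (coordCircle i)) :
    ∃ r : CornerSpace n m → ℝ, ContDiffOn ℝ ∞ r (corner n m) ∧
      ∀ᶠ w in 𝓝[corner n m] w₀, w.1 i • r w = (φ w).1 j := by
  obtain ⟨W, hW, hw₀W, hWsource⟩ := mem_nhdsWithin.1 (h.source_mem_nhdsWithin w₀ hw₀)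
  have hsub : corner n m ∩ W ⊆ φ.source := fun w hw => hWsource hw.symm
  exact exists_contDiffOn_corner_eventually_smul_eq i hW
    ((contDiffOn_pi.1 h.contDiffOn.fst j).mono hsub)
    (fun w hw => (h.apply_eq_zero_iff (hsub hw) hA).2) hw₀W

theorem exists_contDiffOn_ne_zero_eventually_eq_smul (h : IsCornerDiffeo A φ)
    (hw₀ : w₀ ∈ φ.source) (hA : A ⁻¹' range (coordCircle j) = range (coordCircle i)) :
    ∃ r : CornerSpace n m → ℝ, ContDiffOn ℝ ∞ r (corner n m) ∧ r w₀ ≠ 0 ∧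
      ∀ᶠ w in 𝓝[corner n m] w₀, w.1 i • r w = (φ w).1 j := by
  have hA_symm : A.symm ⁻¹' range (coordCircle i) = range (coordCircle j) := by
    rw [← hA, ← preimage_comp]
    exact congrArg (· ⁻¹' _) (funext A.apply_symm_apply)
  have hφw₀ := φ.map_source hw₀
  obtain ⟨r, hr, hrφ⟩ := h.exists_contDiffOn_eventually_eq_smul hw₀ hA
  obtain ⟨g, hg, hgφ⟩ := h.symm.exists_contDiffOn_eventually_eq_smul hφw₀ hA_symm
  refine ⟨r, hr, fun hr0 => ?_, hrφ⟩
  have hrg : Tendsto (fun w => r w * g (φ w)) (𝓝[corner n m] w₀) (𝓝 0) := by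
    rw [← zero_mul (g (φ w₀)), ← hr0]
    exact (hr.continuousOn w₀ (h.source_subset hw₀)).tendsto.mul
      ((hg.continuousOn _ (h.target_subset hφw₀)).tendsto.comp (h.tendsto hw₀))
  obtain ⟨w, ⟨-, hw⟩, hne, hw_source, hrw, hgw⟩ := exists_mem_stratum_of_eventually (S := ∅)
    (h.source_subset hw₀) (by simp) ((hrg.eventually_ne zero_ne_one).and
      (.and (h.source_mem_nhdsWithin w₀ hw₀) (hrφ.and ((h.tendsto hw₀).eventually hgφ))))
  rw [φ.left_inv hw_source, ← hrw, smul_eq_mul, smul_eq_mul, mul_assoc] at hgw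
  exact hne (mul_left_cancel₀ (hw i (notMem_empty i)).ne' (hgw.trans (mul_one _).symm))

end IsCornerDiffeo

end CornerDiffeo

section StandardModel

variable {n l m : ℕ}

theorem stdOrbitMap_mem_corner (x : StdSpace n l m) : stdOrbitMap x ∈ corner n m :=
  fun _ => sq_nonneg _

theorem stdOrbitMap_fst_eq_zero_iff {x : StdSpace n l m} {i : Fin n} :
    (stdOrbitMap x).1 i = 0 ↔ x.1 i = 0 := by simp [stdOrbitMap]

theorem contMDiff_stdOrbitMap : ContMDiff (stdModel n l m) 𝓘(ℝ, CornerSpace n m) ∞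
    (stdOrbitMap : StdSpace n l m → CornerSpace n m) := by
  have hnorm : ContDiff ℝ ∞ fun z : Fin n → ℂ => fun i => ‖z i‖ ^ 2 :=
    contDiff_pi.2 fun i => (contDiff_apply ℝ ℂ i).norm_sq ℝ
  exact (hnorm.contMDiff.comp contMDiff_fst).prodMk_space (contMDiff_snd.comp contMDiff_snd)

theorem tendsto_stdOrbitMap (x : StdSpace n l m) :
    Tendsto stdOrbitMap (𝓝 x) (𝓝[corner n m] stdOrbitMap x) :=
  tendsto_nhdsWithin_of_tendsto_nhds_of_eventually_within _
    contMDiff_stdOrbitMap.continuous.continuousAt (.of_forall stdOrbitMap_mem_corner)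

theorem continuous_stdSection : Continuous (stdSection : CornerSpace n m → StdSpace n l m) := by
  unfold stdSection; fun_prop

theorem stdOrbitMap_stdSection {w : CornerSpace n m} (hw : w ∈ corner n m) :
    stdOrbitMap (stdSection w : StdSpace n l m) = w := by
  refine Prod.ext (funext fun i => ?_) rfl
  simp [stdOrbitMap, stdSection, Real.sq_sqrt (hw i)]

theorem stdAct_phases_stdSection (x : StdSpace n l m) :
    stdAct (phases x) (stdSection (stdOrbitMap x)) = x := by
  refine Prod.ext (funext fun i => ?_) (Prod.ext (mul_one _) rfl)
  simp only [stdAct, phases, stdSection, stdOrbitMap, Real.sqrt_sq (norm_nonneg _)]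
  rw [mul_comm, norm_mul_phase]

theorem stdAct_stdSection_eq_iff (t : Torus n × Torus l) {w : CornerSpace n m}
    (hw : w ∈ corner n m) :
    stdAct t (stdSection w : StdSpace n l m) = stdSection w ↔ t ∈ stdIsotropy w := by
  have hroot : ∀ i, ((√(w.1 i) : ℝ) : ℂ) = 0 ↔ w.1 i = 0 := fun i => by
    rw [Complex.ofReal_eq_zero, Real.sqrt_eq_zero (hw i)]
  have hcoord : ∀ i, (t.1 i : ℂ) * ((√(w.1 i) : ℝ) : ℂ) = ((√(w.1 i) : ℝ) : ℂ) ↔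
      (w.1 i ≠ 0 → t.1 i = 1) := fun i => by
    rw [mul_left_eq_self₀, hroot, Circle.coe_eq_one]; tauto
  simp only [stdAct, stdSection, stdIsotropy, Prod.ext_iff, mul_one, and_true, funext_iff,
    hcoord, mem_ofPred_eq, Pi.one_apply]

theorem contMDiffAt_comp_stdOrbitMap {F H N : Type*} [NormedAddCommGroup F] [NormedSpace ℝ F]
    [TopologicalSpace H] {I : ModelWithCorners ℝ F H} [TopologicalSpace N] [ChartedSpace H N]
    {f : CornerSpace n m → N} {x : StdSpace n l m}
    (hf : ContMDiffWithinAt 𝓘(ℝ, CornerSpace n m) I ∞ f (corner n m) (stdOrbitMap x)) :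
    ContMDiffAt (stdModel n l m) I ∞ (fun y : StdSpace n l m => f (stdOrbitMap y)) x :=
  hf.comp (s := univ) x contMDiff_stdOrbitMap.contMDiffAt fun y _ => stdOrbitMap_mem_corner y

theorem contMDiffAt_sqrt_comp_stdOrbitMap {f : CornerSpace n m → ℝ} {x : StdSpace n l m}
    (hf : ContDiffWithinAt ℝ ∞ f (corner n m) (stdOrbitMap x)) (hx : f (stdOrbitMap x) ≠ 0) :
    ContMDiffAt (stdModel n l m) 𝓘(ℝ, ℂ) ∞
      (fun y : StdSpace n l m => ((√(f (stdOrbitMap y)) : ℝ) : ℂ)) x :=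
  contMDiffAt_comp_stdOrbitMap
    (Complex.ofRealCLM.contDiff.contDiffAt.comp_contDiffWithinAt _
      (hf.sqrt hx)).contMDiffWithinAt

/-- The character of `T^n × T^l` given by the `i`-th coordinate of the first factor. -/
def coordProj (i : Fin n) : Torus n × Torus l →ₜ* Circle where
  toFun t := t.1 i
  map_one' := rfl
  map_mul' _ _ := rfl
  continuous_toFun := (continuous_apply i).comp continuous_fst

/-- The character of `T^n × T^l` given by the `i`-th coordinate of the second factor. -/
def coordProjSnd (i : Fin l) : Torus n × Torus l →ₜ* Circle where
  toFun t := t.2 i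
  map_one' := rfl
  map_mul' _ _ := rfl
  continuous_toFun := (continuous_apply i).comp continuous_snd

theorem contMDiffAt_norm_mul_character_phases {χ : Torus n × Torus l →ₜ* Circle}
    {x : StdSpace n l m} {i : Fin n} (hinj : Function.Injective fun z => χ (coordCircle i z))
    (hχ : ∀ i', x.1 i' = 0 → i' ≠ i → ∀ z, χ (coordCircle i' z) = 1) :
    ContMDiffAt (stdModel n l m) 𝓘(ℝ, ℂ) ∞
      (fun y : StdSpace n l m => (‖y.1 i‖ : ℂ) * χ (phases y)) x := by
  set ε : Circle →ₜ* Circle := χ.comp (coordCircle i)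
  set χ' : Torus n × Torus l →ₜ* Circle := χ / ε.comp (coordProj i)
  have hχ' : ∀ t, χ t = ε (t.1 i) * χ' t := fun t => (mul_div_cancel _ _).symm
  have hsmooth : ContMDiffAt (stdModel n l m) (𝓡 1) ∞
      (fun y : StdSpace n l m => χ' (phases y)) x := by
    refine contMDiffAt_character_phases χ' fun i' hi' z => ?_
    rcases eq_or_ne i' i with rfl | hne
    · change χ (coordCircle i' z) / ε ((coordCircle (l := l) i' z).1 i') = 1
      rw [coordCircle_fst_self]
      exact div_self' _
    · change χ (coordCircle i' z) / ε ((coordCircle (l := l) i' z).1 i) = 1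
      rw [coordCircle_fst_of_ne hne.symm, hχ i' hi' hne, map_one, div_one]
  have hcoord : ContMDiffAt (stdModel n l m) 𝓘(ℝ, ℂ) ∞
      (fun y : StdSpace n l m => y.1 i) x := contMDiffAt_pi_space.1 contMDiffAt_fst i
  have hε : ContMDiffAt (stdModel n l m) 𝓘(ℝ, ℂ) ∞
      (fun y : StdSpace n l m => (‖y.1 i‖ : ℂ) * ε (phase (y.1 i))) x := by
    rcases circle_hom_eq_id_or_inv_of_injective (χ := ε) hinj with hid | hinv
    · simpa only [hid, norm_mul_phase] using hcoord
    · simp only [hinv, norm_mul_phase_inv]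
      exact Complex.conjCLE.contDiff.contMDiff.contMDiffAt.comp x hcoord
  refine (contMDiffAt_complex_mul hε (contMDiff_circle_coe.contMDiffAt.comp x hsmooth)
    ).congr_of_eventuallyEq (.of_forall fun y => ?_)
  change (‖y.1 i‖ : ℂ) * χ (phases y) = ‖y.1 i‖ * ε (phase (y.1 i)) * χ' (phases y)
  rw [hχ', Circle.coe_mul, ← mul_assoc]
  rfl

end StandardModel

section EquivariantLift

variable {n l m n' l' m' : ℕ}

/-- The map of standard spaces which covers `φ` and is equivariant along `A`, normalized so as to
send `stdSection w` to `stdSection (φ w)`. -/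
noncomputable def equivariantLift (A : Torus n × Torus l ≃ₜ* Torus n' × Torus l')
    (φ : CornerSpace n m → CornerSpace n' m') (x : StdSpace n l m) : StdSpace n' l' m' :=
  stdAct (A (phases x)) (stdSection (φ (stdOrbitMap x)))

variable {A : Torus n × Torus l ≃ₜ* Torus n' × Torus l'}

theorem injective_of_preimage_range_coordCircle {i : Fin n} {j : Fin n'}
    (hA : A ⁻¹' range (coordCircle j) = range (coordCircle i)) :
    Function.Injective fun z => (A (coordCircle i z)).1 j := fun z z' hzz' => by
  have hj : ∀ z, coordCircle j ((A (coordCircle i z)).1 j) = A (coordCircle i z) := fun z => by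
    obtain ⟨ζ, hζ⟩ := (hA.symm ▸ mem_range_self z : coordCircle i z ∈ A ⁻¹' range (coordCircle j))
    rw [← hζ, coordCircle_fst_self]
  exact coordCircle_injective i (A.injective ((hj z).symm.trans ((congrArg _ hzz').trans (hj z'))))

namespace IsCornerDiffeo

variable {φ : PartialEquiv (CornerSpace n m) (CornerSpace n' m')} {x : StdSpace n l m}

theorem contDiffWithinAt (h : IsCornerDiffeo A φ) {w : CornerSpace n m} (hw : w ∈ φ.source) :
    ContDiffWithinAt ℝ ∞ φ (corner n m) w :=
  (h.contDiffOn w hw).mono_of_mem_nhdsWithin (h.source_mem_nhdsWithin w hw)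

theorem map_coordCircle_mem_stdIsotropy (h : IsCornerDiffeo A φ) (hx : stdOrbitMap x ∈ φ.source)
    {i : Fin n} (hi : x.1 i = 0) (z : Circle) :
    A (coordCircle i z) ∈ stdIsotropy (φ (stdOrbitMap x)) := by
  rw [← mem_preimage, h.preimage_stdIsotropy _ hx]
  exact coordCircle_mem_stdIsotropy (stdOrbitMap_fst_eq_zero_iff.2 hi) z

theorem contMDiffAt_equivariantLift_fst (h : IsCornerDiffeo A φ)
    (hx : stdOrbitMap x ∈ φ.source) (j : Fin n') :
    ContMDiffAt (stdModel n l m) 𝓘(ℝ, ℂ) ∞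
      (fun y : StdSpace n l m => (equivariantLift A φ y).1 j) x := by
  let χ : Torus n × Torus l →ₜ* Circle :=
    (coordProj (l := l') j).comp (A : Torus n × Torus l →ₜ* Torus n' × Torus l')
  change ContMDiffAt (stdModel n l m) 𝓘(ℝ, ℂ) ∞
    (fun y : StdSpace n l m => (χ (phases y) : ℂ) * ((√((φ (stdOrbitMap y)).1 j) : ℝ) : ℂ)) x
  by_cases hj : (φ (stdOrbitMap x)).1 j = 0
  · obtain ⟨i, -, hA⟩ := h.exists_preimage_range_coordCircle hx hj
    obtain ⟨r, hr, hr0, hrφ⟩ := h.exists_contDiffOn_ne_zero_eventually_eq_smul hx hA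
    have hχ : ContMDiffAt (stdModel n l m) 𝓘(ℝ, ℂ) ∞
        (fun y : StdSpace n l m => (‖y.1 i‖ : ℂ) * χ (phases y)) x :=
      contMDiffAt_norm_mul_character_phases (injective_of_preimage_range_coordCircle hA)
        fun i' hi' hne => h.map_coordCircle_eq_one_of_ne hx hA
          (stdOrbitMap_fst_eq_zero_iff.2 hi') hne
    have hroot := contMDiffAt_sqrt_comp_stdOrbitMap (hr _ (h.source_subset hx)) hr0
    refine (contMDiffAt_complex_mul hχ hroot).congr_of_eventuallyEq ?_
    filter_upwards [(tendsto_stdOrbitMap x).eventually hrφ] with y hy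
    have hnorm : √((stdOrbitMap y).1 i) = ‖y.1 i‖ := Real.sqrt_sq (norm_nonneg _)
    rw [← hy, smul_eq_mul, Real.sqrt_mul (stdOrbitMap_mem_corner y i), hnorm, Complex.ofReal_mul]
    ring
  · have hχ := contMDiffAt_character_phases χ (x := x) fun i hi z =>
      (h.map_coordCircle_mem_stdIsotropy hx hi z).1 j hj
    exact contMDiffAt_complex_mul (contMDiff_circle_coe.contMDiffAt.comp x hχ)
      (contMDiffAt_sqrt_comp_stdOrbitMap
        (contDiffWithinAt_pi.1 (h.contDiffWithinAt hx).fst j) hj)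

theorem contMDiffAt_equivariantLift (h : IsCornerDiffeo A φ) (hx : stdOrbitMap x ∈ φ.source) :
    ContMDiffAt (stdModel n l m) (stdModel n' l' m') ∞ (equivariantLift A φ) x := by
  refine (contMDiffAt_pi_space.2 (h.contMDiffAt_equivariantLift_fst hx)).prodMk
    (ContMDiffAt.prodMk (contMDiffAt_torus_iff.2 fun j => ?_) ?_)
  · let χ : Torus n × Torus l →ₜ* Circle :=
      (coordProjSnd (n := n') j).comp (A : Torus n × Torus l →ₜ* Torus n' × Torus l')
    exact (contMDiffAt_character_phases χ fun i hi z =>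
      congrFun (h.map_coordCircle_mem_stdIsotropy hx hi z).2 j).congr_of_eventuallyEq
        (.of_forall fun y => mul_one _)
  · exact contMDiffAt_comp_stdOrbitMap (h.contDiffWithinAt hx).snd.contMDiffWithinAt

end IsCornerDiffeo

end EquivariantLift

section OrbitSpace

variable {k d : ℕ} {M : Type*} [MulAction (Torus k) M]

theorem orbitMk_eq_iff {x y : M} : orbitMk k x = orbitMk k y ↔ ∃ t : Torus k, t • y = x :=
  Quotient.eq.trans MulAction.orbitRel_apply

theorem orbitMk_smul (t : Torus k) (x : M) : orbitMk k (t • x) = orbitMk k x :=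
  orbitMk_eq_iff.2 ⟨t, rfl⟩

theorem mem_characteristicFunction {t : Torus k} {x : M} :
    t ∈ characteristicFunction k (orbitMk k x) ↔ t • x = x := Iff.rfl

variable [TopologicalSpace M]

theorem continuous_orbitMk : Continuous (orbitMk k : M → OrbitSpace k M) := continuous_quot_mk

variable [ChartedSpace (EuclideanSpace ℝ (Fin d)) M]

namespace StandardChart

variable (c : StandardChart k d M)

theorem symm_mem (v : StdSpace c.n c.l c.m) : c.e.symm v ∈ c.e.source :=
  c.e.map_target (c.target_eq ▸ mem_univ v)

theorem apply_symm (v : StdSpace c.n c.l c.m) : c.e (c.e.symm v) = v :=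
  c.e.right_inv (c.target_eq ▸ mem_univ v)

theorem symm_stdAct (t : Torus k) (v : StdSpace c.n c.l c.m) :
    c.e.symm (stdAct (c.split t) v) = t • c.e.symm v := by
  rw [← c.e.left_inv (c.smul_mem t _ (c.symm_mem v)), c.equivariant t _ (c.symm_mem v),
    c.apply_symm]

theorem symm_eq_smul_localSection (v : StdSpace c.n c.l c.m) :
    c.e.symm v = c.split.symm (phases v) • c.localSection (stdOrbitMap v) := by
  rw [localSection, ← c.symm_stdAct, ContinuousMulEquiv.apply_symm_apply,
    stdAct_phases_stdSection]

theorem contMDiffAt_apply {x : M} (hx : x ∈ c.e.source) :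
    ContMDiffAt (𝓡 d) (stdModel c.n c.l c.m) ∞ c.e x :=
  c.contMDiffOn_toFun.contMDiffAt (c.e.open_source.mem_nhds hx)

theorem orbitMk_mem_orbitDomain {x : M} : orbitMk k x ∈ c.orbitDomain ↔ x ∈ c.e.source := by
  refine ⟨fun ⟨y, hy, hyx⟩ => ?_, fun hx => ⟨x, hx, rfl⟩⟩
  obtain ⟨t, rfl⟩ := orbitMk_eq_iff.1 hyx.symm
  exact c.smul_mem t y hy

theorem isOpen_orbitDomain : IsOpen c.orbitDomain := by
  have hpreimage : orbitMk k ⁻¹' c.orbitDomain = c.e.source :=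
    Set.ext fun _ => c.orbitMk_mem_orbitDomain
  exact isOpen_coinduced.2 (hpreimage ▸ c.e.open_source)

theorem orbitMk_symm (v : StdSpace c.n c.l c.m) :
    orbitMk k (c.e.symm v) = c.orbitChartInv (stdOrbitMap v) := by
  rw [c.symm_eq_smul_localSection, orbitMk_smul, orbitChartInv]

theorem continuous_orbitChartInv : Continuous c.orbitChartInv :=
  continuous_orbitMk.comp (c.contMDiff_invFun.continuous.comp continuous_stdSection)

theorem orbitChartInv_mem_orbitDomain (w : CornerSpace c.n c.m) :
    c.orbitChartInv w ∈ c.orbitDomain := c.orbitMk_mem_orbitDomain.2 (c.symm_mem _)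

theorem orbitChart_orbitMk {x : M} (hx : x ∈ c.e.source) :
    c.orbitChart (orbitMk k x) = stdOrbitMap (c.e x) := if_pos hx

/-- The chart of the orbit space induced by a standard chart, as a partial equivalence from its
domain onto the corner. -/
noncomputable def orbitPartialEquiv : PartialEquiv (OrbitSpace k M) (CornerSpace c.n c.m) where
  toFun := c.orbitChart
  invFun := c.orbitChartInv
  source := c.orbitDomain
  target := corner c.n c.m
  map_source' := by
    rintro _ ⟨x, hx, rfl⟩
    rw [c.orbitChart_orbitMk hx]
    exact stdOrbitMap_mem_corner _
  map_target' w _ := c.orbitChartInv_mem_orbitDomain w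
  left_inv' := by
    rintro _ ⟨x, hx, rfl⟩
    rw [c.orbitChart_orbitMk hx, ← c.orbitMk_symm, c.e.left_inv hx]
  right_inv' w hw := by
    rw [orbitChartInv, localSection, c.orbitChart_orbitMk (c.symm_mem _), c.apply_symm,
      stdOrbitMap_stdSection hw]

variable {c}

theorem orbitChart_mem_corner {p : OrbitSpace k M} (hp : p ∈ c.orbitDomain) :
    c.orbitChart p ∈ corner c.n c.m := c.orbitPartialEquiv.map_source hp

theorem orbitChartInv_orbitChart {p : OrbitSpace k M} (hp : p ∈ c.orbitDomain) :
    c.orbitChartInv (c.orbitChart p) = p := c.orbitPartialEquiv.left_inv hp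

theorem orbitChart_orbitChartInv {w : CornerSpace c.n c.m} (hw : w ∈ corner c.n c.m) :
    c.orbitChart (c.orbitChartInv w) = w := c.orbitPartialEquiv.right_inv hw

theorem tendsto_orbitChartInv {p : OrbitSpace k M} (hp : p ∈ c.orbitDomain) :
    Tendsto c.orbitChartInv (𝓝 (c.orbitChart p)) (𝓝 p) :=
  c.continuous_orbitChartInv.tendsto' _ _ (orbitChartInv_orbitChart hp)

theorem smul_localSection_eq_iff {t : Torus k} {w : CornerSpace c.n c.m}
    (hw : w ∈ corner c.n c.m) :
    t • c.localSection w = c.localSection w ↔ c.split t ∈ stdIsotropy w := by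
  rw [localSection, ← c.symm_stdAct, ← stdAct_stdSection_eq_iff _ hw]
  exact (Function.LeftInverse.injective c.apply_symm).eq_iff

theorem mem_characteristicFunction_iff {t : Torus k} {p : OrbitSpace k M}
    (hp : p ∈ c.orbitDomain) :
    t ∈ characteristicFunction k p ↔ c.split t ∈ stdIsotropy (c.orbitChart p) := by
  rw [← smul_localSection_eq_iff (orbitChart_mem_corner hp), ← mem_characteristicFunction]
  change _ ↔ t ∈ characteristicFunction k (c.orbitChartInv (c.orbitChart p))
  rw [orbitChartInv_orbitChart hp]

theorem contDiffOn_orbitChart_comp_orbitChartInv (c c' : StandardChart k d M) :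
    ContDiffOn ℝ ∞ (fun w => c'.orbitChart (c.orbitChartInv w))
      (corner c.n c.m ∩ c.orbitChartInv ⁻¹' c'.orbitDomain) := by
  refine CornerSpace.contDiffOn_corner_inter_of_comp_sq
    (c'.isOpen_orbitDomain.preimage c.continuous_orbitChartInv) fun q hq => ?_
  let realPoint : CornerSpace c.n c.m → StdSpace c.n c.l c.m := fun q =>
    (fun i => (q.1 i : ℂ), 1, q.2)
  have hreal : ContMDiff 𝓘(ℝ, CornerSpace c.n c.m) (stdModel c.n c.l c.m) ∞ realPoint := by
    have hfst : ContDiff ℝ ∞ fun q : CornerSpace c.n c.m => fun i => (q.1 i : ℂ) :=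
      contDiff_pi.2 fun i => Complex.ofRealCLM.contDiff.comp (by fun_prop)
    exact hfst.contMDiff.prodMk (contMDiff_const.prodMk contDiff_snd.contMDiff)
  have horbit : ∀ q, orbitMk k (c.e.symm (realPoint q)) = c.orbitChartInv (CornerSpace.sq q) :=
    fun q => by
      rw [c.orbitMk_symm]
      congr 1
      exact Prod.ext (funext fun i => by simp [realPoint, stdOrbitMap, CornerSpace.sq]) rfl
  have hsource : ∀ q, c.orbitChartInv (CornerSpace.sq q) ∈ c'.orbitDomain →
      c.e.symm (realPoint q) ∈ c'.e.source := fun q hq => by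
    rwa [← c'.orbitMk_mem_orbitDomain, horbit]
  have hsmooth : ContMDiffAt 𝓘(ℝ, CornerSpace c.n c.m) 𝓘(ℝ, CornerSpace c'.n c'.m) ∞
      (fun q => stdOrbitMap (c'.e (c.e.symm (realPoint q)))) q :=
    contMDiff_stdOrbitMap.contMDiffAt.comp q ((c'.contMDiffAt_apply (hsource q hq)).comp q
      (c.contMDiff_invFun.comp hreal).contMDiffAt)
  refine hsmooth.contDiffAt.contDiffWithinAt.congr (fun q' hq' => ?_) ?_
  · rw [Function.comp_apply, ← horbit, c'.orbitChart_orbitMk (hsource q' hq')]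
  · rw [Function.comp_apply, ← horbit, c'.orbitChart_orbitMk (hsource q hq)]

theorem contDiffWithinAt_orbitChart_comp_orbitChartInv {c c' : StandardChart k d M}
    {p : OrbitSpace k M} (hp : p ∈ c.orbitDomain) (hp' : p ∈ c'.orbitDomain) :
    ContDiffWithinAt ℝ ∞ (fun w => c'.orbitChart (c.orbitChartInv w)) (corner c.n c.m)
      (c.orbitChart p) :=
  (contDiffOn_orbitChart_comp_orbitChartInv c c' _ ⟨orbitChart_mem_corner hp,
    by rwa [mem_preimage, orbitChartInv_orbitChart hp]⟩).mono_of_mem_nhdsWithin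
    (inter_mem_nhdsWithin _ ((tendsto_orbitChartInv hp).eventually
      (c'.isOpen_orbitDomain.mem_nhds hp')))

end StandardChart

end OrbitSpace

section OrbitDiffeomorphism

variable {k d₁ d₂ : ℕ} {M₁ M₂ : Type*}
  [TopologicalSpace M₁] [ChartedSpace (EuclideanSpace ℝ (Fin d₁)) M₁] [MulAction (Torus k) M₁]
  [TopologicalSpace M₂] [ChartedSpace (EuclideanSpace ℝ (Fin d₂)) M₂] [MulAction (Torus k) M₂]
  {c₁ : StandardChart k d₁ M₁} {c₂ : StandardChart k d₂ M₂}

open StandardChart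

theorem OrbitSmoothAt.contDiffWithinAt {Φ : OrbitSpace k M₁ → OrbitSpace k M₂}
    {p : OrbitSpace k M₁} (h : OrbitSmoothAt k d₁ d₂ Φ p) (hp : p ∈ c₁.orbitDomain)
    (hΦp : Φ p ∈ c₂.orbitDomain) :
    ContDiffWithinAt ℝ ∞ (fun w => c₂.orbitChart (Φ (c₁.orbitChartInv w))) (corner c₁.n c₁.m)
      (c₁.orbitChart p) := by
  obtain ⟨hcont, b₁, b₂, hp', hΦp', W, hW, hpW, hΦ⟩ := h
  have hmid : ContDiffWithinAt ℝ ∞ (fun w => b₂.orbitChart (Φ (b₁.orbitChartInv w)))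
      (corner b₁.n b₁.m) (b₁.orbitChart p) :=
    (hΦ _ ⟨orbitChart_mem_corner hp', hpW⟩).mono_of_mem_nhdsWithin
      (inter_mem_nhdsWithin _ (hW.mem_nhds hpW))
  have hinv := tendsto_orbitChartInv hp
  have hnear : ∀ᶠ w in 𝓝[corner c₁.n c₁.m] c₁.orbitChart p,
      c₁.orbitChartInv w ∈ b₁.orbitDomain ∧ Φ (c₁.orbitChartInv w) ∈ b₂.orbitDomain :=
    ((hinv.eventually (b₁.isOpen_orbitDomain.mem_nhds hp')).and ((hcont.tendsto.comp
      hinv).eventually (b₂.isOpen_orbitDomain.mem_nhds hΦp'))).filter_mono nhdsWithin_le_nhds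
  have hleft := hmid.comp_of_preimage_mem_nhdsWithin_of_eq _
    (contDiffWithinAt_orbitChart_comp_orbitChartInv hp hp')
    (hnear.mono fun w hw => orbitChart_mem_corner hw.1)
    (congrArg b₁.orbitChart (orbitChartInv_orbitChart hp))
  have hright := (contDiffWithinAt_orbitChart_comp_orbitChartInv hΦp'
    hΦp).comp_of_preimage_mem_nhdsWithin_of_eq _ hleft
    (hnear.mono fun w hw => ?_) ?_
  · refine hright.congr_of_eventuallyEq_of_mem (hnear.mono fun w hw => ?_)
      (orbitChart_mem_corner hp)
    simp only [Function.comp_apply, orbitChartInv_orbitChart hw.1, orbitChartInv_orbitChart hw.2]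
  · simpa only [mem_preimage, Function.comp_apply, orbitChartInv_orbitChart hw.1]
      using orbitChart_mem_corner hw.2
  · simp only [Function.comp_apply, orbitChartInv_orbitChart hp, orbitChartInv_orbitChart hp']

/-- The map between corners which represents a bijection of orbit spaces in the charts induced by
two standard charts. -/
noncomputable def orbitCoord (c₁ : StandardChart k d₁ M₁) (c₂ : StandardChart k d₂ M₂)
    (Φ : OrbitSpace k M₁ ≃ OrbitSpace k M₂) :
    PartialEquiv (CornerSpace c₁.n c₁.m) (CornerSpace c₂.n c₂.m) :=
  c₁.orbitPartialEquiv.symm.trans (Φ.transPartialEquiv c₂.orbitPartialEquiv)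

variable {Φ : OrbitSpace k M₁ ≃ OrbitSpace k M₂}

theorem mem_orbitCoord_source {w : CornerSpace c₁.n c₁.m} : w ∈ (orbitCoord c₁ c₂ Φ).source ↔
    w ∈ corner c₁.n c₁.m ∧ Φ (c₁.orbitChartInv w) ∈ c₂.orbitDomain := Iff.rfl

theorem orbitCoord_apply (w : CornerSpace c₁.n c₁.m) :
    orbitCoord c₁ c₂ Φ w = c₂.orbitChart (Φ (c₁.orbitChartInv w)) := rfl

theorem orbitChart_mem_orbitCoord_source {p : OrbitSpace k M₁} (hp : p ∈ c₁.orbitDomain)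
    (hΦp : Φ p ∈ c₂.orbitDomain) : c₁.orbitChart p ∈ (orbitCoord c₁ c₂ Φ).source :=
  mem_orbitCoord_source.2
    ⟨orbitChart_mem_corner hp, by rwa [orbitChartInv_orbitChart hp]⟩

theorem orbitCoord_source_mem_nhdsWithin (hΦ : Continuous Φ) {w : CornerSpace c₁.n c₁.m}
    (hw : w ∈ (orbitCoord c₁ c₂ Φ).source) :
    (orbitCoord c₁ c₂ Φ).source ∈ 𝓝[corner c₁.n c₁.m] w :=
  inter_mem_nhdsWithin _ ((c₂.isOpen_orbitDomain.preimage
    (hΦ.comp c₁.continuous_orbitChartInv)).mem_nhds hw.2)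

theorem contDiffOn_orbitCoord (hΦ : ∀ p, OrbitSmoothAt k d₁ d₂ Φ p) :
    ContDiffOn ℝ ∞ (orbitCoord c₁ c₂ Φ) (orbitCoord c₁ c₂ Φ).source := fun w hw => by
  obtain ⟨hcorner, hdomain⟩ := mem_orbitCoord_source.1 hw
  have hsmooth := (hΦ _).contDiffWithinAt (c₁.orbitChartInv_mem_orbitDomain w) hdomain
  exact (orbitChart_orbitChartInv hcorner ▸ hsmooth).mono inter_subset_left

theorem preimage_stdIsotropy_orbitCoord
    (hchar : ∀ p, characteristicFunction k p = characteristicFunction k (Φ p))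
    {w : CornerSpace c₁.n c₁.m} (hw : w ∈ (orbitCoord c₁ c₂ Φ).source) :
    c₁.split.symm.trans c₂.split ⁻¹' stdIsotropy (orbitCoord c₁ c₂ Φ w) = stdIsotropy w := by
  obtain ⟨hcorner, hdomain⟩ := mem_orbitCoord_source.1 hw
  ext t
  rw [mem_preimage, ContinuousMulEquiv.trans_apply, orbitCoord_apply,
    ← mem_characteristicFunction_iff hdomain, ← hchar,
    mem_characteristicFunction_iff (c₁.orbitChartInv_mem_orbitDomain w),
    ContinuousMulEquiv.apply_symm_apply, orbitChart_orbitChartInv hcorner]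

theorem IsOrbitDiffeomorphism.isCornerDiffeo_orbitCoord (hΦ : IsOrbitDiffeomorphism k d₁ d₂ Φ)
    (hchar : ∀ p, characteristicFunction k p = characteristicFunction k (Φ p)) :
    IsCornerDiffeo (c₁.split.symm.trans c₂.split) (orbitCoord c₁ c₂ Φ) where
  source_subset := inter_subset_left
  target_subset := inter_subset_left
  source_mem_nhdsWithin _ hw :=
    orbitCoord_source_mem_nhdsWithin (continuous_iff_continuousAt.2 fun p => (hΦ.1 p).1) hw
  target_mem_nhdsWithin _ hv :=
    orbitCoord_source_mem_nhdsWithin (c₁ := c₂) (c₂ := c₁) (Φ := Φ.symm)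
      (continuous_iff_continuousAt.2 fun q => (hΦ.2 q).1) hv
  contDiffOn := contDiffOn_orbitCoord hΦ.1
  contDiffOn_symm := contDiffOn_orbitCoord (c₁ := c₂) (c₂ := c₁) (Φ := Φ.symm) hΦ.2
  preimage_stdIsotropy _ hw := preimage_stdIsotropy_orbitCoord hchar hw

end OrbitDiffeomorphism

section EquivariantExtension

open MulAction

variable {G X Y : Type*} [Group G] [MulAction G X] [MulAction G Y]
  {s : orbitRel.Quotient G X → X} {g : orbitRel.Quotient G X → Y}

theorem exists_smul_section_eq (hs : ∀ p, Quotient.mk (orbitRel G X) (s p) = p) (x : X) :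
    ∃ t : G, t • s (Quotient.mk _ x) = x :=
  orbitRel_apply.1 (Quotient.exact (hs _).symm)

/-- The equivariant map which extends `g` along a section `s` of the orbit map; it sends `t • s p`
to `t • g p`. -/
noncomputable def equivariantExtension (hs : ∀ p, Quotient.mk (orbitRel G X) (s p) = p)
    (hg : ∀ p, stabilizer G (s p) ≤ stabilizer G (g p)) : X →[G] Y where
  toFun x := (exists_smul_section_eq hs x).choose • g (Quotient.mk _ x)
  map_smul' u x := by
    have hux : Quotient.mk (orbitRel G X) (u • x) = Quotient.mk _ x :=
      Quotient.sound (orbitRel_apply.2 (mem_orbit x u))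
    have ht := (exists_smul_section_eq hs x).choose_spec
    have ht' := (exists_smul_section_eq hs (u • x)).choose_spec
    set t := (exists_smul_section_eq hs x).choose
    set t' := (exists_smul_section_eq hs (u • x)).choose
    rw [hux] at ht' ⊢
    have hstab : (u * t)⁻¹ * t' ∈ stabilizer G (s (Quotient.mk _ x)) := by
      rw [mem_stabilizer_iff, mul_smul, ht', inv_smul_eq_iff, mul_smul, ht]
    have hfix := hg _ hstab
    rwa [mem_stabilizer_iff, mul_smul, inv_smul_eq_iff, mul_smul] at hfix

theorem equivariantExtension_section (hs : ∀ p, Quotient.mk (orbitRel G X) (s p) = p)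
    (hg : ∀ p, stabilizer G (s p) ≤ stabilizer G (g p)) (p : orbitRel.Quotient G X) :
    equivariantExtension hs hg (s p) = g p := by
  have ht := (exists_smul_section_eq hs (s p)).choose_spec
  change (exists_smul_section_eq hs (s p)).choose • g (Quotient.mk _ (s p)) = g p
  simp only [hs] at ht ⊢
  exact hg p ht

theorem eq_of_eqOn_section (hs : ∀ p, Quotient.mk (orbitRel G X) (s p) = p) {F F' : X → Y}
    (hF : ∀ (t : G) x, F (t • x) = t • F x) (hF' : ∀ (t : G) x, F' (t • x) = t • F' x)
    (h : ∀ p, F (s p) = F' (s p)) : F = F' := funext fun x => by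
  obtain ⟨t, ht⟩ := exists_smul_section_eq hs x
  rw [← ht, hF, hF', h]

theorem exists_mulActionHom_apply_section_eq {k : ℕ} {M₁ M₂ : Type*} [MulAction (Torus k) M₁]
    [MulAction (Torus k) M₂] {Φ : OrbitSpace k M₁ → OrbitSpace k M₂}
    {s₁ : OrbitSpace k M₁ → M₁} {s₂ : OrbitSpace k M₂ → M₂}
    (hs₁ : ∀ p, orbitMk k (s₁ p) = p) (hs₂ : ∀ q, orbitMk k (s₂ q) = q)
    (hchar : ∀ p, characteristicFunction k p = characteristicFunction k (Φ p)) :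
    ∃ Ψ : M₁ →[Torus k] M₂, ∀ p, Ψ (s₁ p) = s₂ (Φ p) := by
  refine ⟨_, equivariantExtension_section hs₁ fun p t ht => ?_⟩
  rwa [mem_stabilizer_iff, ← mem_characteristicFunction, hs₂, ← hchar, ← hs₁ p,
    mem_characteristicFunction]

end EquivariantExtension

section Smoothness

variable {k d₁ d₂ : ℕ} {M₁ M₂ : Type*}
  [TopologicalSpace M₁] [ChartedSpace (EuclideanSpace ℝ (Fin d₁)) M₁] [MulAction (Torus k) M₁]
  [TopologicalSpace M₂] [ChartedSpace (EuclideanSpace ℝ (Fin d₂)) M₂] [MulAction (Torus k) M₂]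
  {c₁ : StandardChart k d₁ M₁} {c₂ : StandardChart k d₂ M₂}
  {Φ : OrbitSpace k M₁ ≃ OrbitSpace k M₂}
  {s₁ : OrbitSpace k M₁ → M₁} {s₂ : OrbitSpace k M₂ → M₂} {Ψ : M₁ → M₂}

open StandardChart

theorem apply_localSection_eq_smul (hΨ : ∀ (t : Torus k) x, Ψ (t • x) = t • Ψ x)
    (hs : ∀ p, Ψ (s₁ p) = s₂ (Φ p)) {w : CornerSpace c₁.n c₁.m}
    (hw : w ∈ (orbitCoord c₁ c₂ Φ).source) {t₁ t₂ : Torus k}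
    (h₁ : s₁ (c₁.orbitChartInv w) = t₁ • c₁.localSection w)
    (h₂ : s₂ (c₂.orbitChartInv (orbitCoord c₁ c₂ Φ w)) =
      t₂ • c₂.localSection (orbitCoord c₁ c₂ Φ w)) :
    Ψ (c₁.localSection w) = (t₁⁻¹ * t₂) • c₂.localSection (orbitCoord c₁ c₂ Φ w) := by
  have hΦ : c₂.orbitChartInv (orbitCoord c₁ c₂ Φ w) = Φ (c₁.orbitChartInv w) :=
    orbitChartInv_orbitChart (mem_orbitCoord_source.1 hw).2
  rw [mul_smul, ← h₂, hΦ, ← hs, h₁, hΨ, inv_smul_smul]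

theorem IsRegularSection.exists_contMDiffWithinAt (hs : IsRegularSection k d₁ s₁)
    (p : OrbitSpace k M₁) : ∃ c : StandardChart k d₁ M₁, p ∈ c.orbitDomain ∧
      ∃ f : CornerSpace c.n c.m → Torus k,
        ContMDiffWithinAt 𝓘(ℝ, CornerSpace c.n c.m) (torusModel k) ∞ f (corner c.n c.m)
          (c.orbitChart p) ∧
        ∀ᶠ w in 𝓝[corner c.n c.m] c.orbitChart p,
          s₁ (c.orbitChartInv w) = f w • c.localSection w := by
  obtain ⟨c, hp, W, hW, hpW, f, hf, hsf⟩ := hs.regular p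
  have hnear : corner c.n c.m ∩ W ∈ 𝓝[corner c.n c.m] c.orbitChart p :=
    inter_mem_nhdsWithin _ (hW.mem_nhds hpW)
  exact ⟨c, hp, f, (hf _ ⟨orbitChart_mem_corner hp, hpW⟩).mono_of_mem_nhdsWithin hnear,
    eventually_of_mem hnear hsf⟩

theorem exists_contMDiffWithinAt_apply_localSection_eq (hs₁ : IsRegularSection k d₁ s₁)
    (hs₂ : IsRegularSection k d₂ s₂) (hΦ : IsOrbitDiffeomorphism k d₁ d₂ Φ)
    (hΨ : ∀ (t : Torus k) x, Ψ (t • x) = t • Ψ x) (hs : ∀ p, Ψ (s₁ p) = s₂ (Φ p))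
    (hchar : ∀ p, characteristicFunction k p = characteristicFunction k (Φ p))
    (p : OrbitSpace k M₁) :
    ∃ (c₁ : StandardChart k d₁ M₁) (c₂ : StandardChart k d₂ M₂), p ∈ c₁.orbitDomain ∧
      Φ p ∈ c₂.orbitDomain ∧ ∃ f : CornerSpace c₁.n c₁.m → Torus k,
        ContMDiffWithinAt 𝓘(ℝ, CornerSpace c₁.n c₁.m) (torusModel k) ∞ f (corner c₁.n c₁.m)
          (c₁.orbitChart p) ∧
        ∀ᶠ w in 𝓝[corner c₁.n c₁.m] c₁.orbitChart p,
          Ψ (c₁.localSection w) = f w • c₂.localSection (orbitCoord c₁ c₂ Φ w) := by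
  obtain ⟨c₁, hp, f₁, hf₁, hsf₁⟩ := hs₁.exists_contMDiffWithinAt p
  obtain ⟨c₂, hΦp, f₂, hf₂, hsf₂⟩ := hs₂.exists_contMDiffWithinAt (Φ p)
  have hφ := hΦ.isCornerDiffeo_orbitCoord (c₁ := c₁) (c₂ := c₂) hchar
  have hsource := orbitChart_mem_orbitCoord_source hp hΦp
  have hφp : orbitCoord c₁ c₂ Φ (c₁.orbitChart p) = c₂.orbitChart (Φ p) := by
    rw [orbitCoord_apply, orbitChartInv_orbitChart hp]
  rw [← hφp] at hf₂ hsf₂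
  have htendsto := hφ.tendsto hsource
  have hf₂φ := (hf₂.comp' _ (hφ.contDiffWithinAt hsource).contMDiffWithinAt
    ).mono_of_mem_nhdsWithin (inter_mem self_mem_nhdsWithin (htendsto self_mem_nhdsWithin))
  refine ⟨c₁, c₂, hp, hΦp, _, contMDiffWithinAt_torus_mul (contMDiffWithinAt_torus_inv hf₁) hf₂φ,
    ?_⟩
  filter_upwards [hφ.source_mem_nhdsWithin _ hsource, hsf₁, htendsto.eventually hsf₂]
    with w hw h₁ h₂
  exact apply_localSection_eq_smul hΨ hs hw h₁ h₂

theorem apply_symm_eq_smul_equivariantLift (hΨ : ∀ (t : Torus k) x, Ψ (t • x) = t • Ψ x)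
    {φ : CornerSpace c₁.n c₁.m → CornerSpace c₂.n c₂.m} {t : Torus k}
    {v : StdSpace c₁.n c₁.l c₁.m}
    (h : Ψ (c₁.localSection (stdOrbitMap v)) = t • c₂.localSection (φ (stdOrbitMap v))) :
    Ψ (c₁.e.symm v) =
      t • c₂.e.symm (equivariantLift (c₁.split.symm.trans c₂.split) φ v) := by
  rw [c₁.symm_eq_smul_localSection, hΨ, h, smul_comm, equivariantLift,
    ContinuousMulEquiv.trans_apply, c₂.symm_stdAct, localSection]

variable [ContMDiffSMul (torusModel k) (𝓡 d₂) ∞ (Torus k) M₂]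

theorem contMDiffAt_apply_symm (hΨ : ∀ (t : Torus k) x, Ψ (t • x) = t • Ψ x)
    {φ : PartialEquiv (CornerSpace c₁.n c₁.m) (CornerSpace c₂.n c₂.m)}
    (hφ : IsCornerDiffeo (c₁.split.symm.trans c₂.split) φ) {v : StdSpace c₁.n c₁.l c₁.m}
    (hv : stdOrbitMap v ∈ φ.source) {f : CornerSpace c₁.n c₁.m → Torus k}
    (hf : ContMDiffWithinAt 𝓘(ℝ, CornerSpace c₁.n c₁.m) (torusModel k) ∞ f
      (corner c₁.n c₁.m) (stdOrbitMap v))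
    (hΨf : ∀ᶠ w in 𝓝[corner c₁.n c₁.m] stdOrbitMap v,
      Ψ (c₁.localSection w) = f w • c₂.localSection (φ w)) :
    ContMDiffAt (stdModel c₁.n c₁.l c₁.m) (𝓡 d₂) ∞ (fun v => Ψ (c₁.e.symm v)) v := by
  have hlift := c₂.contMDiff_invFun.contMDiffAt.comp v (hφ.contMDiffAt_equivariantLift hv)
  refine ((contMDiffAt_comp_stdOrbitMap hf).smul hlift).congr_of_eventuallyEq ?_
  filter_upwards [(tendsto_stdOrbitMap v).eventually hΨf] with u hu
  exact apply_symm_eq_smul_equivariantLift hΨ hu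

theorem contMDiff_of_apply_section_eq (hs₁ : IsRegularSection k d₁ s₁)
    (hs₂ : IsRegularSection k d₂ s₂) (hΦ : IsOrbitDiffeomorphism k d₁ d₂ Φ)
    (hchar : ∀ p, characteristicFunction k p = characteristicFunction k (Φ p))
    (hΨ : ∀ (t : Torus k) x, Ψ (t • x) = t • Ψ x) (hs : ∀ p, Ψ (s₁ p) = s₂ (Φ p)) :
    ContMDiff (𝓡 d₁) (𝓡 d₂) ∞ Ψ := fun x => by
  obtain ⟨c₁, c₂, hp, hΦp, f, hf, hΨf⟩ :=
    exists_contMDiffWithinAt_apply_localSection_eq hs₁ hs₂ hΦ hΨ hs hchar (orbitMk k x)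
  have hx : x ∈ c₁.e.source := c₁.orbitMk_mem_orbitDomain.1 hp
  have hsource := orbitChart_mem_orbitCoord_source hp hΦp
  rw [c₁.orbitChart_orbitMk hx] at hf hΨf hsource
  have hsymm := contMDiffAt_apply_symm hΨ (hΦ.isCornerDiffeo_orbitCoord hchar) hsource hf hΨf
  refine (hsymm.comp x (c₁.contMDiffAt_apply hx)).congr_of_eventuallyEq ?_
  filter_upwards [c₁.e.open_source.mem_nhds hx] with y hy
  rw [Function.comp_apply, c₁.e.left_inv hy]

end Smoothness

theorem mainTheorem2_general (k d₁ d₂ : ℕ)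
    (M₁ : Type*) [TopologicalSpace M₁] [ChartedSpace (EuclideanSpace ℝ (Fin d₁)) M₁]
    [MulAction (Torus k) M₁] [ContMDiffSMul (torusModel k) (𝓡 d₁) ∞ (Torus k) M₁]
    (M₂ : Type*) [TopologicalSpace M₂] [ChartedSpace (EuclideanSpace ℝ (Fin d₂)) M₂]
    [MulAction (Torus k) M₂] [ContMDiffSMul (torusModel k) (𝓡 d₂) ∞ (Torus k) M₂]
    (s₁ : OrbitSpace k M₁ → M₁) (hs₁ : IsRegularSection k d₁ s₁)
    (s₂ : OrbitSpace k M₂ → M₂) (hs₂ : IsRegularSection k d₂ s₂)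
    (Φ : OrbitSpace k M₁ ≃ OrbitSpace k M₂) (hΦ : IsOrbitDiffeomorphism k d₁ d₂ Φ)
    (hchar : ∀ p, characteristicFunction k p = characteristicFunction k (Φ p)) :
    ∃! Ψ : Diffeomorph (𝓡 d₁) (𝓡 d₂) M₁ M₂ ∞,
      (∀ (t : Torus k) (x : M₁), Ψ (t • x) = t • Ψ x) ∧ ∀ p, Ψ (s₁ p) = s₂ (Φ p) := by
  have hchar' (q) : characteristicFunction k q = characteristicFunction k (Φ.symm q) := by
    rw [hchar, Φ.apply_symm_apply]
  obtain ⟨Ψ, hΨ⟩ := exists_mulActionHom_apply_section_eq hs₁.isSection hs₂.isSection hchar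
  obtain ⟨Ψ', hΨ'⟩ := exists_mulActionHom_apply_section_eq hs₂.isSection hs₁.isSection hchar'
  have hleft : Ψ' ∘ Ψ = id := eq_of_eqOn_section hs₁.isSection (fun t x => by simp)
    (fun _ _ => rfl) fun p => by simp [hΨ, hΨ']
  have hright : Ψ ∘ Ψ' = id := eq_of_eqOn_section hs₂.isSection (fun t x => by simp)
    (fun _ _ => rfl) fun q => by simp [hΨ, hΨ']
  refine ⟨⟨⟨Ψ, Ψ', congrFun hleft, congrFun hright⟩,
    contMDiff_of_apply_section_eq hs₁ hs₂ hΦ hchar Ψ.map_smul hΨ,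
    contMDiff_of_apply_section_eq hs₂ hs₁ ⟨hΦ.2, hΦ.1⟩ hchar' Ψ'.map_smul hΨ'⟩,
    ⟨Ψ.map_smul, hΨ⟩, fun Θ hΘ => Diffeomorph.ext <| congrFun ?_⟩
  exact eq_of_eqOn_section hs₁.isSection hΘ.1 Ψ.map_smul fun p => (hΘ.2 p).trans (hΨ p).symm

theorem mainTheorem2 (k d₁ d₂ : ℕ)
    (M₁ : Type*) [TopologicalSpace M₁] [T2Space M₁] [SecondCountableTopology M₁]
    [ChartedSpace (EuclideanSpace ℝ (Fin d₁)) M₁] [IsManifold (𝓡 d₁) ∞ M₁]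
    [MulAction (Torus k) M₁] [ContMDiffSMul (torusModel k) (𝓡 d₁) ∞ (Torus k) M₁]
    (M₂ : Type*) [TopologicalSpace M₂] [T2Space M₂] [SecondCountableTopology M₂]
    [ChartedSpace (EuclideanSpace ℝ (Fin d₂)) M₂] [IsManifold (𝓡 d₂) ∞ M₂]
    [MulAction (Torus k) M₂] [ContMDiffSMul (torusModel k) (𝓡 d₂) ∞ (Torus k) M₂]
    (hM₁ : IsLocallyStandard k d₁ M₁) (hM₂ : IsLocallyStandard k d₂ M₂)
    (s₁ : OrbitSpace k M₁ → M₁) (hs₁ : IsRegularSection k d₁ s₁)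
    (s₂ : OrbitSpace k M₂ → M₂) (hs₂ : IsRegularSection k d₂ s₂)
    (Φ : OrbitSpace k M₁ ≃ OrbitSpace k M₂) (hΦ : IsOrbitDiffeomorphism k d₁ d₂ Φ)
    (hchar : ∀ p, characteristicFunction k p = characteristicFunction k (Φ p)) :
    ∃! Ψ : Diffeomorph (𝓡 d₁) (𝓡 d₂) M₁ M₂ ∞,
      (∀ (t : Torus k) (x : M₁), Ψ (t • x) = t • Ψ x) ∧ ∀ p, Ψ (s₁ p) = s₂ (Φ p) :=
  mainTheorem2_general k d₁ d₂ M₁ M₂ s₁ hs₁ s₂ hs₂ Φ hΦ hchar
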